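/- Let $\mathbb H$ be a separable real Hilbert space, and let $\mathcal H,\hat{\mathcal H}$ be compact self-adjoint operators on $\mathbb H$ with non-negative eigenvalues. Write $\mathcal H=\sum_k\lambda_k\mathcal Q_k$ and $\hat{\mathcal H}=\sum_k\hat\lambda_k\hat{\mathcal Q}_k$, where $\mathcal Q_kw=\langle\psi_k,w\rangle\psi_k$, $\hat{\mathcal Q}_kw=\langle\hat\psi_k,w\rangle\hat\psi_k$, both $(\psi_k)$ and $(\hat\psi_k)$ are orthonormal, $\lambda_1\ge\lambda_2\ge\dots\ge0$ and $\hat\lambda_1\ge\hat\lambda_2\ge\dots\ge0$; here $k$ ranges over $\mathbb N=\{1,2,\dots\}$ if $\dim\mathbb H=\infty$, and over $\{1,\dots,d\}$ if $\dim\mathbb H=d<\infty$. Let $\mathcal Q_\infty$ be the orthogonal projection onto the orthogonal complement of all $\psi_k$ (so $\mathcal Q_\infty=0$ if $(\psi_k)$ is an orthonormal basis, and in general $\mathcal H\mathcal Q_\infty=0$). Let $\mathcal J$ be a non-empty finite set of indices, not the set of all indices, with $$\gamma_{\mathcal J}:=\inf_{k\in\mathcal J,\ \ell\notin\mathcal J}|\lambda_k-\lambda_\ell|>0.$$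 Let $\theta_1>\dots>\theta_K$ be the distinct values of $\lambda_k$, $k\in\mathcal J$, and put $\mathcal J_j=\{k\in\mathcal J:\lambda_k=\theta_j\}$, $\mathcal P_{\mathcal J_j}=\sum_{k\in\mathcal J_j}\mathcal Q_k$, $U_{\mathcal J}=\bigcup_{j=1}^K\{z\in\mathbb C:|z-\theta_j|<\gamma_{\mathcal J}/2\}$ and $\Gamma_{\mathcal J}=\partial U_{\mathcal J}$. Let $f:\mathbb C\to\mathbb C$ be holomorphic on an open set containing the closure $\overline{U_{\mathcal J}}$, and suppose that $\|\hat{\mathcal H}-\mathcal H\|/\gamma_{\mathcal J}<1/4$. Write $E=\hat{\mathcal H}-\mathcal H$. Then, with operators extended complex-linearly to the complexification of $\mathbb H$ and with the operator norm there, $$\Big\|\sum_{k\in\mathcal J}f(\hat\lambda_k)\hat{\mathcal Q}_k-\sum_{k\in\mathcal J}f(\lambda_k)\mathcal Q_k-\nabla\mathrm{Cmp}\Big\|\le 8K\,\sup_{z\in\Gamma_{\mathcal J}}|f(z)|\,\Big(\frac{\|\hat{\mathcal H}-\mathcal H\|}{\gamma_{\mathcal J}}\Big)^2,$$ where $\nabla\mathrm{Cmp}=\nabla\mathrm{Cmp}_1+\nabla\mathrm{Cmp}_2+\nabla\mathrm{Cmp}_3$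 and $$\nabla\mathrm{Cmp}_1=\sum_{j=1}^Kf'(\theta_j)\,\mathcal P_{\mathcal J_j}E\,\mathcal P_{\mathcal J_j},\qquad \nabla\mathrm{Cmp}_2=\sum_{\substack{1\le j_1,j_2\le K\\ j_1\ne j_2}}\frac{f(\theta_{j_2})-f(\theta_{j_1})}{\theta_{j_2}-\theta_{j_1}}\,\mathcal P_{\mathcal J_{j_1}}E\,\mathcal P_{\mathcal J_{j_2}},$$ $$\nabla\mathrm{Cmp}_3=\sum_{k\in\mathcal J}f(\lambda_k)\Big[\sum_{\ell\notin\mathcal J}\frac{\mathcal Q_kE\mathcal Q_\ell+\mathcal Q_\ell E\mathcal Q_k}{\lambda_k-\lambda_\ell}+\frac{\mathcal Q_kE\mathcal Q_\infty+\mathcal Q_\infty E\mathcal Q_k}{\lambda_k}\Big].$$ The sums over $\ell\notin\mathcal J$ converge unconditionally in operator norm. The last fraction is absent (zero) whenever $(\psi_k)$ is an orthonormal basis of $\mathbb H$; if $(\psi_k)$ is not a basis, then $\lambda_k>0$ for all $k\in\mathcal J$. -/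

import Mathlib

open scoped InnerProductSpace

set_option linter.unusedSectionVars false

noncomputable section

namespace SpecPert

universe u

/-! ### Complexification of a real Hilbert space -/

/-- The complexification `H ⊕ iH` of a real Hilbert space. The pair `(x, y)` stands for `x + i y`,
and `‖x + i y‖ ^ 2 = ‖x‖ ^ 2 + ‖y‖ ^ 2`. -/
def Complexification (H : Type u) : Type u := WithLp 2 (H × H)

section Complexification

variable {H : Type u} [NormedAddCommGroup H] [InnerProductSpace ℝ H]

instance : NormedAddCommGroup (Complexification H) :=
  inferInstanceAs (NormedAddCommGroup (WithLp 2 (H × H)))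

instance [CompleteSpace H] : CompleteSpace (Complexification H) :=
  inferInstanceAs (CompleteSpace (WithLp 2 (H × H)))

namespace Complexification

/-- The vector `x + i y`. -/
def mk (x y : H) : Complexification H := WithLp.toLp 2 (x, y)

/-- Real part. -/
def re (v : Complexification H) : H := WithLp.fst v

/-- Imaginary part. -/
def im (v : Complexification H) : H := WithLp.snd v

@[simp] theorem re_mk (x y : H) : (mk x y).re = x := rfl

@[simp] theorem im_mk (x y : H) : (mk x y).im = y := rfl

@[ext] theorem ext {v w : Complexification H} (h₁ : v.re = w.re) (h₂ : v.im = w.im) : v = w := by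
  have : (WithLp.ofLp v : H × H) = WithLp.ofLp w := Prod.ext h₁ h₂
  exact WithLp.ofLp_injective 2 this

@[simp] theorem re_add (v w : Complexification H) : (v + w).re = v.re + w.re := rfl

@[simp] theorem im_add (v w : Complexification H) : (v + w).im = v.im + w.im := rfl

@[simp] theorem re_zero : (0 : Complexification H).re = 0 := rfl

@[simp] theorem im_zero : (0 : Complexification H).im = 0 := rfl

theorem norm_sq_eq (v : Complexification H) : ‖v‖ ^ 2 = ‖v.re‖ ^ 2 + ‖v.im‖ ^ 2 :=
  WithLp.prod_norm_sq_eq_of_L2 (α := H) (β := H) v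

/-- `(a + i b) (x + i y) = (a x - b y) + i (b x + a y)`. -/
instance : SMul ℂ (Complexification H) :=
  ⟨fun c v => mk (c.re • v.re - c.im • v.im) (c.im • v.re + c.re • v.im)⟩

@[simp] theorem re_smul (c : ℂ) (v : Complexification H) :
    (c • v).re = c.re • v.re - c.im • v.im := rfl

@[simp] theorem im_smul (c : ℂ) (v : Complexification H) :
    (c • v).im = c.im • v.re + c.re • v.im := rfl

instance : Module ℂ (Complexification H) where
  one_smul v := by ext <;> simp
  mul_smul c d v := by
    ext <;> simp only [re_smul, im_smul, Complex.mul_re, Complex.mul_im] <;> module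
  smul_zero c := by ext <;> simp
  smul_add c v w := by
    ext <;> simp only [re_smul, im_smul, re_add, im_add] <;> module
  add_smul c d v := by
    ext <;> simp only [re_smul, im_smul, re_add, im_add, Complex.add_re, Complex.add_im] <;> module
  zero_smul v := by ext <;> simp

theorem norm_smul_eq (c : ℂ) (v : Complexification H) : ‖c • v‖ = ‖c‖ * ‖v‖ := by
  have h : ‖c • v‖ ^ 2 = (‖c‖ * ‖v‖) ^ 2 := by
    rw [mul_pow, norm_sq_eq, norm_sq_eq, re_smul, im_smul, norm_sub_sq_real, norm_add_sq_real,
      Complex.sq_norm, Complex.normSq_apply]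
    simp only [norm_smul, mul_pow, real_inner_smul_left, real_inner_smul_right, Real.norm_eq_abs,
      sq_abs]
    ring
  exact (pow_left_inj₀ (norm_nonneg _) (by positivity) two_ne_zero).1 h

instance : NormedSpace ℂ (Complexification H) where
  norm_smul_le c v := (norm_smul_eq c v).le

/-- `⟪x + i y, u + i w⟫ = (⟪x, u⟫ + ⟪y, w⟫) + i (⟪x, w⟫ - ⟪y, u⟫)`, conjugate-linear on the left. -/
instance : InnerProductSpace ℂ (Complexification H) where
  inner v w := ⟨⟪v.re, w.re⟫_ℝ + ⟪v.im, w.im⟫_ℝ, ⟪v.re, w.im⟫_ℝ - ⟪v.im, w.re⟫_ℝ⟩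
  norm_sq_eq_re_inner v := by
    rw [norm_sq_eq, ← real_inner_self_eq_norm_sq, ← real_inner_self_eq_norm_sq]
    rfl
  conj_inner_symm v w := by
    apply Complex.ext
    · simp [real_inner_comm]
    · simp [real_inner_comm]
  add_left v w z := by
    apply Complex.ext
    · simp only [re_add, im_add, inner_add_left, Complex.add_re]; ring
    · simp only [re_add, im_add, inner_add_left, Complex.add_im]; ring
  smul_left v w c := by
    apply Complex.ext
    · simp only [re_smul, im_smul, inner_add_left, inner_sub_left, real_inner_smul_left,
        Complex.mul_re, Complex.conj_re, Complex.conj_im]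
      ring
    · simp only [re_smul, im_smul, inner_add_left, inner_sub_left, real_inner_smul_left,
        Complex.mul_im, Complex.conj_re, Complex.conj_im]
      ring

end Complexification

/-- The complex-linear extension `x + i y ↦ T x + i T y` of a bounded operator `T`. -/
def complexify (T : H →L[ℝ] H) : Complexification H →L[ℂ] Complexification H :=
  LinearMap.mkContinuous
    { toFun := fun v => Complexification.mk (T v.re) (T v.im)
      map_add' := fun v w => by ext <;> simp
      map_smul' := fun c v => by ext <;> simp }
    ‖T‖ (fun v => by
      refine abs_le_of_sq_le_sq' ?_ (by positivity) |>.2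
      have h₁ := T.le_opNorm v.re
      have h₂ := T.le_opNorm v.im
      have h₁' := pow_le_pow_left₀ (norm_nonneg _) h₁ 2
      have h₂' := pow_le_pow_left₀ (norm_nonneg _) h₂ 2
      rw [mul_pow, Complexification.norm_sq_eq, Complexification.norm_sq_eq]
      simp only [LinearMap.coe_mk, AddHom.coe_mk, Complexification.re_mk, Complexification.im_mk]
      nlinarith)

end Complexification

/-! ### Eigendecompositions and generalized compressions -/

section Spectral

variable {H : Type u} [NormedAddCommGroup H] [InnerProductSpace ℝ H]

/-- The indices of the eigenvalue sequence (counted from `0`): all of `ℕ` if `H` is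
infinite-dimensional, and `0, …, d - 1` if `dim H = d`. -/
abbrev SpecIndex (H : Type u) [NormedAddCommGroup H] [InnerProductSpace ℝ H] : Type :=
  {k : ℕ // (k : Cardinal.{u}) < Module.rank ℝ H}

/-- The rank-one operator `Q_k = ψ_k ⊗ ψ_k`, that is, `w ↦ ⟪ψ_k, w⟫ ψ_k`. -/
def eigProj (ψ : SpecIndex H → H) (k : SpecIndex H) : H →L[ℝ] H :=
  InnerProductSpace.rankOne ℝ (ψ k) (ψ k)

/-- `T = ∑ k, lam k • Q_k` in operator norm, with orthonormal `ψ_k` and non-increasing,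
non-negative `lam k`. -/
structure IsEigenDecomposition (T : H →L[ℝ] H) (lam : SpecIndex H → ℝ) (ψ : SpecIndex H → H) :
    Prop where
  orthonormal : Orthonormal ℝ ψ
  antitone : Antitone lam
  nonneg : ∀ k, 0 ≤ lam k
  hasSum : HasSum (fun k => lam k • eigProj ψ k) T

/-- The spectral gap: the infimum of `|lam k - lam l|` over `k ∈ J`, `l ∉ J`. -/
def gap (lam : SpecIndex H → ℝ) (J : Finset (SpecIndex H)) : ℝ :=
  sInf {r : ℝ | ∃ k ∈ J, ∃ l ∉ J, r = |lam k - lam l|}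

/-- The distinct values `θ_1, …, θ_K` of `lam` on `J`; `K` is the cardinality of this set. -/
def distinctEig (lam : SpecIndex H → ℝ) (J : Finset (SpecIndex H)) : Finset ℝ :=
  J.image lam

/-- The union of the open disks of radius half the gap around the distinct eigenvalues. -/
def diskUnion (lam : SpecIndex H → ℝ) (J : Finset (SpecIndex H)) : Set ℂ :=
  ⋃ θ ∈ distinctEig lam J, Metric.ball (θ : ℂ) (gap lam J / 2)

/-- `∑ k ∈ J, Q_k` over the indices with `lam k = θ`. -/
def clusterProj (lam : SpecIndex H → ℝ) (ψ : SpecIndex H → H) (J : Finset (SpecIndex H)) (θ : ℝ) :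
    H →L[ℝ] H :=
  ∑ k ∈ J with lam k = θ, eigProj ψ k

/-- The orthogonal projection onto the orthogonal complement of all `ψ_k`. It is zero exactly when
the `ψ_k` form an orthonormal basis; in an eigendecomposition of `T` its range lies in `ker T`. -/
def residualProj [CompleteSpace H] (ψ : SpecIndex H → H) : H →L[ℝ] H :=
  (Submodule.span ℝ (Set.range ψ))ᗮ.starProjection

/-- The generalized compression `∑ k ∈ J, f (lam k) Q_k`. -/
def genCmp (lam : SpecIndex H → ℝ) (ψ : SpecIndex H → H) (f : ℂ → ℂ) (J : Finset (SpecIndex H)) :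
    Complexification H →L[ℂ] Complexification H :=
  ∑ k ∈ J, f (lam k) • complexify (eigProj ψ k)

/-- `∑ θ, f'(θ) P_θ E P_θ`. -/
def gradCmp₁ (lam : SpecIndex H → ℝ) (ψ : SpecIndex H → H) (E : H →L[ℝ] H) (f : ℂ → ℂ)
    (J : Finset (SpecIndex H)) : Complexification H →L[ℂ] Complexification H :=
  ∑ θ ∈ distinctEig lam J,
    deriv f (θ : ℂ) • complexify (clusterProj lam ψ J θ * E * clusterProj lam ψ J θ)

/-- `∑ θ ≠ η, (f η - f θ) / (η - θ) P_θ E P_η`. -/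
def gradCmp₂ (lam : SpecIndex H → ℝ) (ψ : SpecIndex H → H) (E : H →L[ℝ] H) (f : ℂ → ℂ)
    (J : Finset (SpecIndex H)) : Complexification H →L[ℂ] Complexification H :=
  ∑ θ ∈ distinctEig lam J, ∑ η ∈ (distinctEig lam J).erase θ,
    ((f (η : ℂ) - f (θ : ℂ)) / ((η : ℂ) - (θ : ℂ))) •
      complexify (clusterProj lam ψ J θ * E * clusterProj lam ψ J η)

/-- The summand `(Q_k E Q_l + Q_l E Q_k) / (lam k - lam l)`. -/
def offDiagTerm (lam : SpecIndex H → ℝ) (ψ : SpecIndex H → H) (E : H →L[ℝ] H)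
    (k l : SpecIndex H) : H →L[ℝ] H :=
  (lam k - lam l)⁻¹ • (eigProj ψ k * E * eigProj ψ l + eigProj ψ l * E * eigProj ψ k)

/-- The same summand for the residual projection, whose eigenvalue is `0`. -/
def residualTerm [CompleteSpace H] (lam : SpecIndex H → ℝ) (ψ : SpecIndex H → H) (E : H →L[ℝ] H)
    (k : SpecIndex H) : H →L[ℝ] H :=
  (lam k)⁻¹ • (eigProj ψ k * E * residualProj ψ + residualProj ψ * E * eigProj ψ k)

/-- `∑ k ∈ J, f (lam k) ∑ l ∉ J, (Q_k E Q_l + Q_l E Q_k) / (lam k - lam l)`, where the inner sum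
includes the residual projection with eigenvalue `0` (a zero term if the `ψ_k` are a basis). -/
def gradCmp₃ [CompleteSpace H] (lam : SpecIndex H → ℝ) (ψ : SpecIndex H → H) (E : H →L[ℝ] H)
    (f : ℂ → ℂ) (J : Finset (SpecIndex H)) : Complexification H →L[ℂ] Complexification H :=
  ∑ k ∈ J, f (lam k) • complexify
    ((∑' l : {l : SpecIndex H // l ∉ J}, offDiagTerm lam ψ E k l) + residualTerm lam ψ E k)

/-- The first-order term, with `E` the perturbation. -/
def gradCmp [CompleteSpace H] (lam : SpecIndex H → ℝ) (ψ : SpecIndex H → H) (E : H →L[ℝ] H)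
    (f : ℂ → ℂ) (J : Finset (SpecIndex H)) : Complexification H →L[ℂ] Complexification H :=
  gradCmp₁ lam ψ E f J + gradCmp₂ lam ψ E f J + gradCmp₃ lam ψ E f J

end Spectral

end SpecPert

end

open SpecPert

/-! The proof is Riesz functional calculus on the boundary Γ of the disk union. Put r = γ/2, R(z) =
(z - T)⁻¹ and R'(z) = (z - That)⁻¹. Cauchy's formula gives ∑_{k ∈ J} f(λ_k) Q_k = (2πi)⁻¹ ∮ f R. By
Weyl's inequality (`IsEigenDecomposition.abs_sub_le`) no eigenvalue moves by more than ‖E‖ < r/2, so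
the same Γ encloses exactly the indices in J for That, and ∮ f R' gives the perturbed compression.

By `resolvent_expansion`, R' - R - R E R = R E R E R'. Near the closed disks R(z) = ∑_θ (z - θ)⁻¹
P_θ + S(z) with S holomorphic (`IsDiagonal.resolvent_eq`). In ∮ f R E R (`contourInt_smul_mul_mul`)
the double poles give f'(θ), pairs of distinct poles give divided differences, and a pole against S
gives the S(θ) terms; expanding S(θ) in eigenvectors yields the third gradient term
(`hasSum_offDiagTerm`, `gradCmp₃_eq`). What remains is ∮ f R E R E R'. On Γ, ‖R‖ ≤ 1/r and ‖R'‖ ≤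
1/(r - ‖E‖) ≤ 2/r, and the length of the contour is at most 2πrK, which gives the bound.

Two constructions support this. The disks may overlap, but their centres are real, so Γ is handled
as upper and lower arcs of a chain of circles, and Cauchy's theorem follows from primitives on the
chain. The function S is built from the resolvent of `moveEig`, in which the eigenvalues indexed by
J are pushed far away from the disks. -/

namespace SpecPert

/-! ### Complexification of operators, resolvents and Hilbert bases -/

section Complexify

variable {H : Type*} [NormedAddCommGroup H] [InnerProductSpace ℝ H]

@[simp] theorem re_complexify (T : H →L[ℝ] H) (v : Complexification H) :
    (complexify T v).re = T v.re := rfl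

@[simp] theorem im_complexify (T : H →L[ℝ] H) (v : Complexification H) :
    (complexify T v).im = T v.im := rfl

theorem norm_complexify_le (T : H →L[ℝ] H) : ‖complexify T‖ ≤ ‖T‖ :=
  LinearMap.mkContinuous_norm_le _ (norm_nonneg _) _

/-- Complexification of bounded operators as a ring homomorphism. -/
noncomputable def complexifyHom :
    (H →L[ℝ] H) →+* (Complexification H →L[ℂ] Complexification H) where
  toFun := complexify
  map_one' := by ext v <;> simp
  map_mul' S T := by ext v <;> simp
  map_zero' := by ext v <;> simp
  map_add' S T := by ext v <;> simp

@[simp] theorem complexifyHom_apply (T : H →L[ℝ] H) : complexifyHom T = complexify T := rfl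

theorem complexify_mul (S T : H →L[ℝ] H) :
    complexify (S * T) = complexify S * complexify T := map_mul complexifyHom S T

theorem complexify_add (S T : H →L[ℝ] H) :
    complexify (S + T) = complexify S + complexify T := map_add complexifyHom S T

theorem complexify_sub (S T : H →L[ℝ] H) :
    complexify (S - T) = complexify S - complexify T := map_sub complexifyHom S T

theorem complexify_one : complexify (1 : H →L[ℝ] H) = 1 := map_one complexifyHom

theorem complexify_sum {ι : Type*} (s : Finset ι) (T : ι → H →L[ℝ] H) :
    complexify (∑ i ∈ s, T i) = ∑ i ∈ s, complexify (T i) := map_sum complexifyHom T s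

theorem complexify_smul (c : ℝ) (T : H →L[ℝ] H) :
    complexify (c • T) = (c : ℂ) • complexify T := by
  ext v
  · change c • T v.re = (c : ℂ).re • T v.re - (c : ℂ).im • T v.im
    simp
  · change c • T v.im = (c : ℂ).im • T v.re + (c : ℂ).re • T v.im
    simp

theorem complexify_resolvent {T : H →L[ℝ] H} {t : ℝ} (ht : t ∈ resolventSet ℝ T) :
    complexify (resolvent T t) = resolvent (complexify T) (t : ℂ) := by
  have key : complexify (algebraMap ℝ (H →L[ℝ] H) t - T) =
      algebraMap ℂ _ (t : ℂ) - complexify T := by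
    rw [complexify_sub, Algebra.algebraMap_eq_smul_one, Algebra.algebraMap_eq_smul_one,
      complexify_smul, complexify_one]
  obtain ⟨u, hu⟩ : IsUnit (algebraMap ℝ (H →L[ℝ] H) t - T) := ht
  rw [resolvent, resolvent, ← key, ← hu, Ring.inverse_unit]
  exact (Ring.inverse_unit (Units.map (complexifyHom (H := H)).toMonoidHom u)).symm

/-- A Hilbert basis of a real Hilbert space is one of its complexification. -/
theorem exists_hilbertBasis_complexification [CompleteSpace H] {ι : Type*}
    (b : HilbertBasis ι ℝ H) :
    ∃ B : HilbertBasis ι ℂ (Complexification H), ∀ i, B i = Complexification.mk (b i) 0 := by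
  classical
  have hinner : ∀ (x : H) (v : Complexification H),
      inner ℂ (Complexification.mk x 0) v = ⟨⟪x, v.re⟫_ℝ, ⟪x, v.im⟫_ℝ⟩ := by
    intro x v
    change (⟨⟪x, v.re⟫_ℝ + ⟪(0 : H), v.im⟫_ℝ, ⟪x, v.im⟫_ℝ - ⟪(0 : H), v.re⟫_ℝ⟩ : ℂ) = _
    simp
  have hon : Orthonormal ℂ fun i => Complexification.mk (b i) 0 := by
    rw [orthonormal_iff_ite]
    intro i j
    rw [hinner]
    have := orthonormal_iff_ite.1 b.orthonormal i j
    apply Complex.ext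
    · simp [this]; split_ifs <;> simp
    · simp; split_ifs <;> simp
  have hzero : ∀ x : H, (∀ i, ⟪b i, x⟫_ℝ = 0) → x = 0 := by
    intro x hx
    have := b.hasSum_repr x
    simp only [HilbertBasis.repr_apply_apply, hx, zero_smul] at this
    exact this.unique hasSum_zero
  have hbot : (Submodule.span ℂ (Set.range fun i => Complexification.mk (b i) (0 : H)))ᗮ = ⊥ := by
    rw [Submodule.eq_bot_iff]
    intro v hv
    have h : ∀ i, inner ℂ (Complexification.mk (b i) 0) v = 0 := fun i =>
      (Submodule.mem_orthogonal _ _).1 hv _ (Submodule.subset_span ⟨i, rfl⟩)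
    ext
    · exact hzero _ fun i => by have := congrArg Complex.re (h i); rwa [hinner] at this
    · exact hzero _ fun i => by have := congrArg Complex.im (h i); rwa [hinner] at this
  exact ⟨HilbertBasis.mkOfOrthogonalEqBot hon hbot, fun i => by simp⟩

end Complexify

/-! ### Operators diagonal in a Hilbert basis: invertibility and norm of the inverse -/

section Diagonal

variable {𝕜 E ι : Type*} [RCLike 𝕜] [NormedAddCommGroup E] [InnerProductSpace 𝕜 E]

/-- `A` multiplies the i-th coordinate by `m i`, so Parseval's identity reduces the claim to a
termwise comparison. -/
theorem mul_norm_le_norm_of_hilbertBasis (b : HilbertBasis ι 𝕜 E) (A : E →L[𝕜] E) {d : ℝ}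
    (hd : 0 ≤ d) (h : ∀ i, ∃ m : 𝕜, A (b i) = m • b i ∧ d ≤ ‖m‖) (x : E) :
    d * ‖x‖ ≤ ‖A x‖ := by
  classical
  choose m hm hdm using h
  have hcoord : ∀ i, b.repr (A x) i = m i * b.repr x i := by
    intro i
    have h1 : HasSum (fun j => b.repr x j • (m j • b j)) (A x) := by
      have := (b.hasSum_repr x).mapL A
      simpa [hm] using this
    have h2 := h1.mapL (innerSL 𝕜 (b i))
    have h3 : HasSum (fun j => innerSL 𝕜 (b i) (b.repr x j • (m j • b j)))
        (innerSL 𝕜 (b i) (b.repr x i • (m i • b i))) := by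
      refine hasSum_single i fun j hj => ?_
      simp [b.orthonormal.2 hj.symm]
    have h4 := h2.unique h3
    rw [HilbertBasis.repr_apply_apply]
    simpa [inner_smul_right, mul_comm, b.orthonormal.1 i] using h4
  have hx := lp.hasSum_norm (p := 2) (by norm_num) (b.repr x)
  have hAx := lp.hasSum_norm (p := 2) (by norm_num) (b.repr (A x))
  rw [b.repr.norm_map] at hx hAx
  have hle : d ^ (2 : ENNReal).toReal * ‖x‖ ^ (2 : ENNReal).toReal
      ≤ ‖A x‖ ^ (2 : ENNReal).toReal := by
    refine hasSum_le (fun i => ?_) (hx.mul_left _) hAx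
    rw [hcoord, norm_mul, ← Real.mul_rpow hd (norm_nonneg _)]
    gcongr
    exact hdm i
  rw [← Real.mul_rpow hd (norm_nonneg _)] at hle
  exact (Real.rpow_le_rpow_iff (by positivity) (norm_nonneg _) (by norm_num)).1 hle

/-- Being bounded below makes `A` injective with closed range, and the range is dense because it
contains every basis vector. -/
theorem isUnit_of_hilbertBasis [CompleteSpace E] (b : HilbertBasis ι 𝕜 E) (A : E →L[𝕜] E) {d : ℝ}
    (hd : 0 < d) (h : ∀ i, ∃ m : 𝕜, A (b i) = m • b i ∧ d ≤ ‖m‖) : IsUnit A := by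
  rw [ContinuousLinearMap.isUnit_iff_bijective,
    ContinuousLinearMap.bijective_iff_dense_range_and_antilipschitz]
  refine ⟨?_, d⁻¹.toNNReal, ContinuousLinearMap.antilipschitz_of_bound _ fun x => ?_⟩
  · rw [← top_le_iff, ← b.dense_span]
    refine Submodule.topologicalClosure_mono (Submodule.span_le.2 ?_)
    rintro _ ⟨i, rfl⟩
    obtain ⟨m, hm, hdm⟩ := h i
    have hm0 : m ≠ 0 := norm_pos_iff.1 (hd.trans_le hdm)
    exact ⟨m⁻¹ • b i, by simp [hm, smul_smul, hm0]⟩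
  · have := mul_norm_le_norm_of_hilbertBasis b A hd.le h x
    rw [Real.coe_toNNReal _ (by positivity), inv_mul_eq_div, le_div_iff₀ hd, mul_comm]
    exact this

theorem norm_inverse_le_of_hilbertBasis [CompleteSpace E] (b : HilbertBasis ι 𝕜 E)
    (A : E →L[𝕜] E) {d : ℝ}
    (hd : 0 < d) (h : ∀ i, ∃ m : 𝕜, A (b i) = m • b i ∧ d ≤ ‖m‖) : ‖Ring.inverse A‖ ≤ d⁻¹ := by
  have hu := isUnit_of_hilbertBasis b A hd h
  refine ContinuousLinearMap.opNorm_le_bound _ (by positivity) fun x => ?_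
  have h1 := mul_norm_le_norm_of_hilbertBasis b A hd.le h (Ring.inverse A x)
  have h2 : A (Ring.inverse A x) = x := by
    rw [← mul_apply_eq_comp, Ring.mul_inverse_cancel A hu,
      one_apply_eq_self]
  rw [h2] at h1
  rw [inv_mul_eq_div, le_div_iff₀ hd, mul_comm]
  exact h1

end Diagonal


/-! ### The boundary of a chain of disks as a contour -/

section Contour

open Real Set Metric

/-- The angle at which the circles of radius `r` around `θ (i - 1)` and `θ i` meet, seen from
`θ (i - 1)`; it is `0` if they do not meet and at both ends of the chain of `K` circles. -/
noncomputable def junctionAngle (θ : ℕ → ℝ) (r : ℝ) (K i : ℕ) : ℝ :=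
  if i = 0 ∨ K ≤ i then 0 else arccos ((θ i - θ (i - 1)) / (2 * r))

/-- The part of the circles of radius `r` around `θ 0, …, θ (K - 1)` that lies outside all of the
open disks: the boundary of their union. -/
def chainBoundary (θ : ℕ → ℝ) (r : ℝ) (K : ℕ) : Set ℂ :=
  {z | (∃ i < K, ‖z - θ i‖ = r) ∧ ∀ j < K, r ≤ ‖z - θ j‖}

/-- The union of the open disks of radius `r` around `θ 0, …, θ (K - 1)`. -/
def diskChain (θ : ℕ → ℝ) (r : ℝ) (K : ℕ) : Set ℂ :=
  {z | ∃ i < K, ‖z - θ i‖ < r}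

variable {E : Type*} [NormedAddCommGroup E] [NormedSpace ℂ E]

/-- The integral of `(2 π i)⁻¹ g` along the boundary of a chain of disks. -/
noncomputable def contourInt (θ : ℕ → ℝ) (r : ℝ) (K : ℕ) (g : ℂ → E) : E :=
  (2 * π * Complex.I)⁻¹ • ∑ i ∈ Finset.range K,
    ((∫ φ in junctionAngle θ r K (i + 1)..π - junctionAngle θ r K i,
        (circleMap 0 r φ * Complex.I) • g (circleMap (θ i) r φ)) +
      ∫ φ in -(π - junctionAngle θ r K i)..-junctionAngle θ r K (i + 1),
        (circleMap 0 r φ * Complex.I) • g (circleMap (θ i) r φ))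

variable {θ : ℕ → ℝ} {r : ℝ} {K : ℕ}

theorem junctionAngle_nonneg (i : ℕ) : 0 ≤ junctionAngle θ r K i := by
  unfold junctionAngle
  split_ifs
  exacts [le_rfl, arccos_nonneg _]

theorem junctionAngle_le (hr : 0 < r) (hθ : ∀ i j, i < j → j < K → θ i < θ j) (i : ℕ) :
    junctionAngle θ r K i ≤ π / 2 := by
  unfold junctionAngle
  split_ifs with h
  · positivity
  · push Not at h
    rw [arccos_le_pi_div_two]
    have := hθ (i - 1) i (by omega) h.2
    exact div_nonneg (by linarith) (by linarith)

/-- Equality holds when the circles meet. Otherwise the quotient is at least 1, `arccos` returns 0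
there, and cos 0 = 1 still suffices. -/
theorem cos_junctionAngle_le (hr : 0 < r) (hθ : ∀ i j, i < j → j < K → θ i < θ j) {i : ℕ}
    (hi : i + 1 < K) : 2 * r * cos (junctionAngle θ r K (i + 1)) ≤ θ (i + 1) - θ i := by
  have hlt := hθ i (i + 1) (by omega) hi
  rw [junctionAngle, if_neg (by omega), Nat.add_sub_cancel]
  set d := (θ (i + 1) - θ i) / (2 * r) with hd
  have hd' : θ (i + 1) - θ i = 2 * r * d := by rw [hd]; field_simp
  have hd0 : 0 ≤ d := div_nonneg (by linarith) (by linarith)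
  rw [hd']
  refine mul_le_mul_of_nonneg_left ?_ (by linarith)
  rcases le_total d 1 with h | h
  · rw [cos_arccos (by linarith) h]
  · exact (cos_le_one _).trans h

theorem normSq_circleMap_sub (c d r φ : ℝ) :
    ‖circleMap c r φ - d‖ ^ 2 = r ^ 2 + (d - c) ^ 2 - 2 * r * (d - c) * cos φ := by
  rw [Complex.sq_norm, Complex.normSq_apply]
  have h1 : (circleMap c r φ - d).re = c + r * cos φ - d := by
    simp [circleMap, Complex.exp_ofReal_mul_I_re]
  have h2 : (circleMap c r φ - d).im = r * sin φ := by
    simp [circleMap, Complex.exp_ofReal_mul_I_im]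
  rw [h1, h2]
  nlinarith [sin_sq_add_cos_sq φ]

/-- By the law of cosines, lying outside the disk around a centre to the right means 2r cos φ ≤ θ j
- θ i, which is most restrictive for j = i + 1; that case is the choice of the junction angle.
Centres to the left are symmetric, so only the two neighbours matter. -/
theorem circleMap_mem_chainBoundary (hr : 0 < r) (hθ : ∀ i j, i < j → j < K → θ i < θ j) {i : ℕ}
    (hi : i < K) {φ : ℝ}
    (hφ : |φ| ∈ Icc (junctionAngle θ r K (i + 1)) (π - junctionAngle θ r K i)) :
    circleMap (θ i) r φ ∈ chainBoundary θ r K := by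
  refine ⟨⟨i, hi, by simp [circleMap, abs_of_pos hr]⟩, fun j hj => ?_⟩
  have hmono : ∀ k l, k ≤ l → l < K → θ k ≤ θ l := fun k l hkl hl => by
    rcases hkl.lt_or_eq with h | rfl
    exacts [(hθ k l h hl).le, le_rfl]
  have ha := junctionAngle_nonneg (θ := θ) (r := r) (K := K) i
  have ha' := junctionAngle_nonneg (θ := θ) (r := r) (K := K) (i + 1)
  refine le_of_sq_le_sq ?_ (norm_nonneg _)
  rw [normSq_circleMap_sub, ← cos_abs φ]
  rcases lt_trichotomy i j with hij | rfl | hij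
  · have h1 := cos_junctionAngle_le hr hθ (i := i) (by omega)
    have h2 : cos |φ| ≤ cos (junctionAngle θ r K (i + 1)) :=
      cos_le_cos_of_nonneg_of_le_pi ha' (by linarith [hφ.2]) hφ.1
    have h3 := hmono (i + 1) j (by omega) hj
    have h4 := hθ i j hij hj
    have h5 := mul_le_mul_of_nonneg_left h2 hr.le
    have h6 : 2 * r * cos |φ| ≤ θ j - θ i := by nlinarith
    nlinarith
  · simp
  · obtain ⟨m, rfl⟩ : ∃ m, i = m + 1 := ⟨i - 1, by omega⟩
    have h1 := cos_junctionAngle_le hr hθ (i := m) hi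
    have h2 : cos (π - junctionAngle θ r K (m + 1)) ≤ cos |φ| :=
      cos_le_cos_of_nonneg_of_le_pi (abs_nonneg _) (by linarith) hφ.2
    rw [cos_pi_sub] at h2
    have h3 := hmono j m (by omega) (by omega)
    have h4 := hθ j (m + 1) hij hi
    have h5 := mul_le_mul_of_nonneg_left h2 hr.le
    have h6 : -(θ (m + 1) - θ j) ≤ 2 * r * cos |φ| := by nlinarith
    nlinarith

theorem junctionAngle_le_sub (hr : 0 < r) (hθ : ∀ i j, i < j → j < K → θ i < θ j) (i : ℕ) :
    junctionAngle θ r K (i + 1) ≤ π - junctionAngle θ r K i := by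
  linarith [junctionAngle_le hr hθ i, junctionAngle_le hr hθ (i + 1)]

theorem abs_mem_of_mem_upper (hr : 0 < r) (hθ : ∀ i j, i < j → j < K → θ i < θ j) {i : ℕ} {φ : ℝ}
    (hφ : φ ∈ uIcc (junctionAngle θ r K (i + 1)) (π - junctionAngle θ r K i)) :
    0 ≤ φ ∧ φ ≤ π ∧
      |φ| ∈ Icc (junctionAngle θ r K (i + 1)) (π - junctionAngle θ r K i) := by
  rw [uIcc_of_le (junctionAngle_le_sub hr hθ i)] at hφ
  have ha := junctionAngle_nonneg (θ := θ) (r := r) (K := K) i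
  have ha' := junctionAngle_nonneg (θ := θ) (r := r) (K := K) (i + 1)
  have h0 : 0 ≤ φ := ha'.trans hφ.1
  exact ⟨h0, by linarith [hφ.2], by rwa [abs_of_nonneg h0]⟩

theorem abs_mem_of_mem_lower (hr : 0 < r) (hθ : ∀ i j, i < j → j < K → θ i < θ j) {i : ℕ} {φ : ℝ}
    (hφ : φ ∈ uIcc (-(π - junctionAngle θ r K i)) (-junctionAngle θ r K (i + 1))) :
    φ ≤ 0 ∧ -π ≤ φ ∧
      |φ| ∈ Icc (junctionAngle θ r K (i + 1)) (π - junctionAngle θ r K i) := by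
  rw [uIcc_of_le (neg_le_neg (junctionAngle_le_sub hr hθ i))] at hφ
  have ha := junctionAngle_nonneg (θ := θ) (r := r) (K := K) i
  have ha' := junctionAngle_nonneg (θ := θ) (r := r) (K := K) (i + 1)
  have h0 : φ ≤ 0 := by linarith [hφ.2]
  exact ⟨h0, by linarith [hφ.1], by
    rw [abs_of_nonpos h0]; exact ⟨by linarith [hφ.2], by linarith [hφ.1]⟩⟩

theorem intervalIntegrable_contour (hr : 0 < r) (hθ : ∀ i j, i < j → j < K → θ i < θ j) {g : ℂ → E}
    (hg : ContinuousOn g (chainBoundary θ r K)) {i : ℕ} (hi : i < K) {s t : ℝ}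
    (hst : ∀ φ ∈ uIcc s t,
      |φ| ∈ Icc (junctionAngle θ r K (i + 1)) (π - junctionAngle θ r K i)) :
    IntervalIntegrable (fun φ => (circleMap 0 r φ * Complex.I) • g (circleMap (θ i) r φ))
      MeasureTheory.volume s t := by
  refine ContinuousOn.intervalIntegrable (ContinuousOn.smul (by fun_prop) ?_)
  exact hg.comp (by fun_prop) fun φ hφ => circleMap_mem_chainBoundary hr hθ hi (hst φ hφ)

theorem contourInt_congr (hr : 0 < r) (hθ : ∀ i j, i < j → j < K → θ i < θ j) {g₁ g₂ : ℂ → E}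
    (h : EqOn g₁ g₂ (chainBoundary θ r K)) : contourInt θ r K g₁ = contourInt θ r K g₂ := by
  unfold contourInt
  congr 1
  refine Finset.sum_congr rfl fun i hi => ?_
  have hi' := Finset.mem_range.1 hi
  congr 1 <;> refine intervalIntegral.integral_congr fun φ hφ => ?_
  · rw [h (circleMap_mem_chainBoundary hr hθ hi' (abs_mem_of_mem_upper hr hθ hφ).2.2)]
  · rw [h (circleMap_mem_chainBoundary hr hθ hi' (abs_mem_of_mem_lower hr hθ hφ).2.2)]

theorem contourInt_add (hr : 0 < r) (hθ : ∀ i j, i < j → j < K → θ i < θ j) {g₁ g₂ : ℂ → E}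
    (h₁ : ContinuousOn g₁ (chainBoundary θ r K)) (h₂ : ContinuousOn g₂ (chainBoundary θ r K)) :
    contourInt θ r K (fun z => g₁ z + g₂ z) = contourInt θ r K g₁ + contourInt θ r K g₂ := by
  unfold contourInt
  rw [← smul_add, ← Finset.sum_add_distrib]
  congr 1
  refine Finset.sum_congr rfl fun i hi => ?_
  have hi' := Finset.mem_range.1 hi
  have hu := fun φ hφ => (abs_mem_of_mem_upper (φ := φ) (i := i) hr hθ hφ).2.2
  have hl := fun φ hφ => (abs_mem_of_mem_lower (φ := φ) (i := i) hr hθ hφ).2.2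
  simp only [smul_add]
  rw [intervalIntegral.integral_add (intervalIntegrable_contour hr hθ h₁ hi' hu)
      (intervalIntegrable_contour hr hθ h₂ hi' hu),
    intervalIntegral.integral_add (intervalIntegrable_contour hr hθ h₁ hi' hl)
      (intervalIntegrable_contour hr hθ h₂ hi' hl)]
  abel

theorem contourInt_sum (hr : 0 < r) (hθ : ∀ i j, i < j → j < K → θ i < θ j) {ι : Type*}
    (s : Finset ι) {g : ι → ℂ → E} (h : ∀ j ∈ s, ContinuousOn (g j) (chainBoundary θ r K)) :
    contourInt θ r K (fun z => ∑ j ∈ s, g j z) = ∑ j ∈ s, contourInt θ r K (g j) := by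
  classical
  induction s using Finset.induction_on with
  | empty => simp [contourInt]
  | insert a s ha ih =>
    simp only [Finset.sum_insert ha]
    rw [contourInt_add hr hθ (h a (by simp))
      (continuousOn_finsetSum s fun j hj => h j (by simp [hj])), ih fun j hj => h j (by simp [hj])]

theorem contourInt_smul (c : ℂ) (g : ℂ → E) :
    contourInt θ r K (fun z => c • g z) = c • contourInt θ r K g := by
  unfold contourInt
  simp only [smul_comm _ c, intervalIntegral.integral_smul, ← smul_add, ← Finset.smul_sum]

theorem contourInt_sub (hr : 0 < r) (hθ : ∀ i j, i < j → j < K → θ i < θ j) {g₁ g₂ : ℂ → E}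
    (h₁ : ContinuousOn g₁ (chainBoundary θ r K)) (h₂ : ContinuousOn g₂ (chainBoundary θ r K)) :
    contourInt θ r K (fun z => g₁ z - g₂ z) = contourInt θ r K g₁ - contourInt θ r K g₂ := by
  have := contourInt_add hr hθ h₁ (g₂ := fun z => (-1 : ℂ) • g₂ z) (h₂.const_smul _)
  rw [contourInt_smul] at this
  simpa [sub_eq_add_neg] using this

theorem contourInt_smul_const [CompleteSpace E] (g : ℂ → ℂ) (v : E) :
    contourInt θ r K (fun z => g z • v) = contourInt θ r K g • v := by
  unfold contourInt
  simp only [← smul_assoc, intervalIntegral.integral_smul_const, ← add_smul, ← Finset.sum_smul]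

/-- The arcs on one circle have total length at most 2πr, and the prefactor (2πi)⁻¹ cancels the 2π.
-/
theorem norm_contourInt_le (hr : 0 < r) (hθ : ∀ i j, i < j → j < K → θ i < θ j) {g : ℂ → E}
    {C : ℝ} (hC : 0 ≤ C) (hg : ∀ z ∈ chainBoundary θ r K, ‖g z‖ ≤ C) :
    ‖contourInt θ r K g‖ ≤ K * r * C := by
  unfold contourInt
  have hb : ∀ i ∈ Finset.range K, ‖(∫ φ in junctionAngle θ r K (i + 1)..π - junctionAngle θ r K i,
        (circleMap 0 r φ * Complex.I) • g (circleMap (θ i) r φ)) +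
      ∫ φ in -(π - junctionAngle θ r K i)..-junctionAngle θ r K (i + 1),
        (circleMap 0 r φ * Complex.I) • g (circleMap (θ i) r φ)‖ ≤ 2 * π * r * C := by
    intro i hi
    have hi' := Finset.mem_range.1 hi
    have ha := junctionAngle_nonneg (θ := θ) (r := r) (K := K) i
    have ha' := junctionAngle_nonneg (θ := θ) (r := r) (K := K) (i + 1)
    have hle := junctionAngle_le_sub hr hθ i
    have hval : ∀ φ : ℝ, circleMap (θ i) r φ ∈ chainBoundary θ r K →
        ‖(circleMap 0 r φ * Complex.I) • g (circleMap (θ i) r φ)‖ ≤ r * C := by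
      intro φ hφ
      rw [norm_smul, norm_mul, Complex.norm_I, norm_circleMap_zero, abs_of_pos hr, mul_one]
      exact mul_le_mul_of_nonneg_left (hg _ hφ) hr.le
    have h1 := intervalIntegral.norm_integral_le_of_norm_le_const (C := r * C)
      (f := fun φ => (circleMap 0 r φ * Complex.I) • g (circleMap (θ i) r φ))
      (a := junctionAngle θ r K (i + 1)) (b := π - junctionAngle θ r K i) fun φ hφ =>
        hval φ (circleMap_mem_chainBoundary hr hθ hi'
          (abs_mem_of_mem_upper hr hθ (uIoc_subset_uIcc hφ)).2.2)
    have h2 := intervalIntegral.norm_integral_le_of_norm_le_const (C := r * C)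
      (f := fun φ => (circleMap 0 r φ * Complex.I) • g (circleMap (θ i) r φ))
      (a := -(π - junctionAngle θ r K i)) (b := -junctionAngle θ r K (i + 1)) fun φ hφ =>
        hval φ (circleMap_mem_chainBoundary hr hθ hi'
          (abs_mem_of_mem_lower hr hθ (uIoc_subset_uIcc hφ)).2.2)
    rw [abs_of_nonneg (by linarith)] at h1 h2
    have hrC : 0 ≤ r * C := by positivity
    refine (norm_add_le _ _).trans ((add_le_add h1 h2).trans ?_)
    nlinarith
  rw [norm_smul]
  have hn : ‖(2 * π * Complex.I : ℂ)⁻¹‖ = (2 * π)⁻¹ := by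
    rw [norm_inv, norm_mul, norm_mul, Complex.norm_I, Complex.norm_real, norm_of_nonneg pi_pos.le]
    simp
  rw [hn]
  calc (2 * π)⁻¹ * _ ≤ (2 * π)⁻¹ * (K * (2 * π * r * C)) := by
        refine mul_le_mul_of_nonneg_left ?_ (by positivity)
        simpa using norm_sum_le_of_le _ hb
    _ = K * r * C := by field_simp

end Contour


/-! ### Cauchy's theorem and integral formulas for a chain of disks -/

section Cauchy

open Real Set Metric

variable {E : Type*} [NormedAddCommGroup E] [NormedSpace ℂ E]
variable {θ : ℕ → ℝ} {r : ℝ} {K : ℕ}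

/-- At each junction either the circles meet, or both junction angles vanish. -/
theorem junction_cases (hr : 0 < r) (hθ : ∀ i j, i < j → j < K → θ i < θ j) {i : ℕ}
    (hi : i + 1 < K) :
    (circleMap (θ i) r (junctionAngle θ r K (i + 1)) =
        circleMap (θ (i + 1)) r (π - junctionAngle θ r K (i + 1)) ∧
      circleMap (θ i) r (-junctionAngle θ r K (i + 1)) =
        circleMap (θ (i + 1)) r (-(π - junctionAngle θ r K (i + 1)))) ∨
    (junctionAngle θ r K (i + 1) = 0 ∧ θ i + r ≤ θ (i + 1) - r) := by
  have hlt := hθ i (i + 1) (by omega) hi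
  rw [junctionAngle, if_neg (by omega), Nat.add_sub_cancel]
  set d := (θ (i + 1) - θ i) / (2 * r) with hd
  have hd' : θ (i + 1) - θ i = 2 * r * d := by rw [hd]; field_simp
  have hd0 : 0 ≤ d := div_nonneg (by linarith) (by linarith)
  rcases le_total d 1 with h | h
  · left
    have hc := cos_arccos (by linarith) h
    have hre : ∀ c φ : ℝ, (circleMap c r φ).re = c + r * cos φ := fun c φ => by
      simp [circleMap, Complex.exp_ofReal_mul_I_re]
    have him : ∀ c φ : ℝ, (circleMap c r φ).im = r * sin φ := fun c φ => by
      simp [circleMap, Complex.exp_ofReal_mul_I_im]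
    constructor <;> apply Complex.ext
    · rw [hre, hre, cos_pi_sub, hc]; linarith
    · rw [him, him, sin_pi_sub]
    · rw [hre, hre, cos_neg, cos_neg, cos_pi_sub, hc]; linarith
    · rw [him, him, sin_neg, sin_neg, sin_pi_sub]
  · right
    refine ⟨arccos_eq_zero.2 h, ?_⟩
    nlinarith

theorem circleMap_zero_angle (c r : ℝ) : circleMap c r 0 = ((c + r : ℝ) : ℂ) := by
  simp [circleMap]

theorem circleMap_pi (c r : ℝ) : circleMap c r π = ((c - r : ℝ) : ℂ) := by
  simp [circleMap, sub_eq_add_neg]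

theorem circleMap_neg_pi (c r : ℝ) : circleMap c r (-π) = ((c - r : ℝ) : ℂ) := by
  simp [circleMap, sub_eq_add_neg, Complex.exp_neg]

/-- Evaluation of the contour integral from primitives on the upper and the lower half of the
contour whose difference takes equal values at the end points of each gap between the disks. -/
theorem contourInt_of_primitives [CompleteSpace E] (hr : 0 < r)
    (hθ : ∀ i j, i < j → j < K → θ i < θ j) (hK : 0 < K) {g P Q : ℂ → E}
    (hg : ContinuousOn g (chainBoundary θ r K))
    (hP : ∀ z ∈ chainBoundary θ r K, 0 ≤ z.im → HasDerivAt P (g z) z)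
    (hQ : ∀ z ∈ chainBoundary θ r K, z.im ≤ 0 → HasDerivAt Q (g z) z)
    (hj : ∀ i, i + 1 < K → θ i + r ≤ θ (i + 1) - r →
      P ((θ i + r : ℝ) : ℂ) - Q ((θ i + r : ℝ) : ℂ) =
        P ((θ (i + 1) - r : ℝ) : ℂ) - Q ((θ (i + 1) - r : ℝ) : ℂ)) :
    contourInt θ r K g = (2 * π * Complex.I)⁻¹ •
      ((P ((θ 0 - r : ℝ) : ℂ) - Q ((θ 0 - r : ℝ) : ℂ)) -
        (P ((θ (K - 1) + r : ℝ) : ℂ) - Q ((θ (K - 1) + r : ℝ) : ℂ))) := by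
  set a := junctionAngle θ r K with ha
  have him : ∀ c φ : ℝ, (circleMap c r φ).im = r * sin φ := fun c φ => by
    simp [circleMap, Complex.exp_ofReal_mul_I_im]
  -- The upper arc runs from the right end of its circle to the left end and the lower arc runs
  -- back, so together they contribute P - Q at the left end minus P - Q at the right end.
  let L : ℕ → E := fun i => P (circleMap (θ i) r (π - a i)) - Q (circleMap (θ i) r (-(π - a i)))
  let R : ℕ → E := fun i => P (circleMap (θ i) r (a (i + 1))) - Q (circleMap (θ i) r (-a (i + 1)))
  have harc : ∀ i ∈ Finset.range K,
      ((∫ φ in a (i + 1)..π - a i, (circleMap 0 r φ * Complex.I) • g (circleMap (θ i) r φ)) +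
      ∫ φ in -(π - a i)..-a (i + 1), (circleMap 0 r φ * Complex.I) • g (circleMap (θ i) r φ)) =
      L i - R i := by
    intro i hi
    have hi' := Finset.mem_range.1 hi
    have hu := fun φ hφ => abs_mem_of_mem_upper (φ := φ) (i := i) hr hθ hφ
    have hl := fun φ hφ => abs_mem_of_mem_lower (φ := φ) (i := i) hr hθ hφ
    have h1 := intervalIntegral.integral_eq_sub_of_hasDerivAt
      (f := fun φ => P (circleMap (θ i) r φ)) (a := a (i + 1)) (b := π - a i)
      (fun φ hφ => (hP _ (circleMap_mem_chainBoundary hr hθ hi' (hu φ hφ).2.2)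
        (by rw [him]; exact mul_nonneg hr.le
              (sin_nonneg_of_nonneg_of_le_pi (hu φ hφ).1 (hu φ hφ).2.1))).scomp φ
        (hasDerivAt_circleMap _ _ _))
      (intervalIntegrable_contour hr hθ hg hi' fun φ hφ => (hu φ hφ).2.2)
    have h2 := intervalIntegral.integral_eq_sub_of_hasDerivAt
      (f := fun φ => Q (circleMap (θ i) r φ)) (a := -(π - a i)) (b := -a (i + 1))
      (fun φ hφ => (hQ _ (circleMap_mem_chainBoundary hr hθ hi' (hl φ hφ).2.2)
        (by rw [him]; exact mul_nonpos_of_nonneg_of_nonpos hr.le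
              (sin_nonpos_of_nonpos_of_neg_pi_le (hl φ hφ).1 (hl φ hφ).2.1))).scomp φ
        (hasDerivAt_circleMap _ _ _))
      (intervalIntegrable_contour hr hθ hg hi' fun φ hφ => (hl φ hφ).2.2)
    rw [h1, h2]
    simp only [L, R]
    abel
  -- Neighbouring end points coincide if the circles meet; across a gap, or at a point of tangency,
  -- the hypothesis `hj` identifies the values. The sum over circles then telescopes.
  have hjn : ∀ i, i + 1 < K → R i = L (i + 1) := by
    intro i hi
    rcases junction_cases hr hθ hi with ⟨h1, h2⟩ | ⟨h1, h2⟩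
    · simp only [L, R, ha, h1, h2]
    · simp only [L, R, ha, h1, sub_zero, neg_zero, circleMap_zero_angle, circleMap_pi,
        circleMap_neg_pi]
      exact hj i hi h2
  obtain ⟨n, rfl⟩ : ∃ n, K = n + 1 := ⟨K - 1, by omega⟩
  have htel : ∑ i ∈ Finset.range (n + 1), (L i - R i) = L 0 - R n := by
    rw [Finset.sum_sub_distrib, Finset.sum_range_succ', Finset.sum_range_succ (f := R),
      Finset.sum_congr rfl fun i hi => hjn i (by simpa using hi)]
    abel
  have h0 : a 0 = 0 := by simp [ha, junctionAngle]
  have hn : a (n + 1) = 0 := by simp [ha, junctionAngle]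
  unfold contourInt
  rw [Finset.sum_congr rfl harc, htel]
  simp only [L, R, h0, hn, sub_zero, neg_zero, circleMap_zero_angle, circleMap_pi,
    circleMap_neg_pi, Nat.add_sub_cancel]

theorem isOpen_diskChain : IsOpen (diskChain θ r K) := by
  have : diskChain θ r K = ⋃ i < K, ball (θ i : ℂ) r := by
    ext z; simp [diskChain, dist_eq_norm]
  rw [this]
  exact isOpen_biUnion fun i _ => isOpen_ball

theorem chainBoundary_subset_diskChain {ρ : ℝ} (hρ : r < ρ) :
    chainBoundary θ r K ⊆ diskChain θ ρ K := fun _ hz => by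
  obtain ⟨i, hi, h⟩ := hz.1
  exact ⟨i, hi, h ▸ hρ⟩

/-- A holomorphic function on a chain of disks has a primitive. -/
theorem exists_primitive_diskChain [CompleteSpace E] {h : ℂ → E}
    (hθ : ∀ i j, i < j → j < K → θ i < θ j)
    (hh : DifferentiableOn ℂ h (diskChain θ r K)) :
    ∃ P : ℂ → E, ∀ z ∈ diskChain θ r K, HasDerivAt P (h z) z := by
  classical
  suffices H : ∀ n ≤ K, ∃ P : ℂ → E, ∀ z ∈ diskChain θ r n, HasDerivAt P (h z) z from H K le_rfl
  intro n
  induction n with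
  | zero => exact fun _ => ⟨0, fun z ⟨i, hi, _⟩ => absurd hi (by omega)⟩
  | succ n ih =>
    intro hn
    obtain ⟨P, hP⟩ := ih (by omega)
    have hball : ball (θ n : ℂ) r ⊆ diskChain θ r K := fun z hz =>
      ⟨n, by omega, by simpa [dist_eq_norm] using hz⟩
    obtain ⟨p, hp⟩ := (hh.mono hball).isExactOn_ball
    -- The new disk meets the earlier ones only inside its immediate predecessor. That overlap is
    -- convex, so two primitives differ there by a constant, which is used to glue them.
    have hconst : ∃ c : E, ∀ z ∈ diskChain θ r n, z ∈ ball (θ n : ℂ) r → P z = p z + c := by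
      obtain rfl | ⟨m, rfl⟩ : n = 0 ∨ ∃ m, n = m + 1 := by
        cases n
        exacts [Or.inl rfl, Or.inr ⟨_, rfl⟩]
      · exact ⟨0, fun z ⟨i, hi, _⟩ => absurd hi (by omega)⟩
      have hsub : ∀ z ∈ diskChain θ r (m + 1), z ∈ ball (θ (m + 1) : ℂ) r →
          z ∈ ball (θ m : ℂ) r ∩ ball (θ (m + 1) : ℂ) r := by
        rintro z ⟨i, hi, hzi⟩ hz
        refine ⟨?_, hz⟩
        rcases Nat.lt_succ_iff_lt_or_eq.1 hi with hi | rfl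
        · have h1 := hθ i m hi (by omega)
          have h2 := hθ m (m + 1) (by omega) (by omega)
          -- The centres are collinear and θ m lies between the other two, both of which are within
          -- r of z; convexity of the ball around z puts θ m within r as well.
          have hseg : (θ m : ℂ) ∈ segment ℝ (θ i : ℂ) (θ (m + 1) : ℂ) := by
            have : θ m ∈ segment ℝ (θ i) (θ (m + 1)) := by
              rw [segment_eq_Icc (by linarith)]; exact ⟨h1.le, h2.le⟩
            obtain ⟨s, t, hs, ht, hst, h⟩ := this
            exact ⟨s, t, hs, ht, hst, by rw [← h]; simp⟩
          have hi' : (θ i : ℂ) ∈ ball z r := by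
            rw [mem_ball, dist_comm, dist_eq_norm]; exact hzi
          rw [mem_ball, dist_comm] at hz ⊢
          exact (convex_ball z r).segment_subset hi' hz hseg
        · rw [mem_ball, dist_eq_norm]; exact hzi
      set N := ball (θ m : ℂ) r ∩ ball (θ (m + 1) : ℂ) r with hN
      have hNo : IsOpen N := isOpen_ball.inter isOpen_ball
      have hNc : IsPreconnected N := ((convex_ball _ _).inter (convex_ball _ _)).isPreconnected
      have hder : ∀ z ∈ N, HasDerivAt (fun w => P w - p w) 0 z := fun z hz => by
        have := (hP z ⟨m, by omega, by simpa [dist_eq_norm] using hz.1⟩).sub (hp z hz.2)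
        rw [sub_self] at this
        exact this
      rcases N.eq_empty_or_nonempty with he | ⟨z₀, hz₀⟩
      · exact ⟨0, fun z h1 h2 => absurd (hsub z h1 h2) (by simp [he])⟩
      · refine ⟨P z₀ - p z₀, fun z h1 h2 => ?_⟩
        have := hNo.is_const_of_deriv_eq_zero hNc
          (fun z hz => (hder z hz).differentiableAt.differentiableWithinAt)
          (fun z hz => (hder z hz).deriv) (hsub z h1 h2) hz₀
        rw [← this]; abel
    obtain ⟨c, hc⟩ := hconst
    refine ⟨fun z => if z ∈ ball (θ n : ℂ) r then p z + c else P z, fun z hz => ?_⟩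
    by_cases hzn : z ∈ ball (θ n : ℂ) r
    · refine ((hp z hzn).add_const c).congr_of_eventuallyEq ?_
      filter_upwards [isOpen_ball.mem_nhds hzn] with w hw
      rw [if_pos hw]
    · have hz' : z ∈ diskChain θ r n := by
        obtain ⟨i, hi, h⟩ := hz
        rcases Nat.lt_succ_iff_lt_or_eq.1 hi with hi | rfl
        · exact ⟨i, hi, h⟩
        · exact absurd (by simpa [dist_eq_norm] using h) hzn
      refine (hP z hz').congr_of_eventuallyEq ?_
      filter_upwards [isOpen_diskChain.mem_nhds hz'] with w hw
      split_ifs with hwn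
      exacts [(hc w hw hwn).symm, rfl]

theorem contourInt_eq_zero [CompleteSpace E] (hr : 0 < r)
    (hθ : ∀ i j, i < j → j < K → θ i < θ j) (hK : 0 < K) {g P : ℂ → E}
    (hg : ContinuousOn g (chainBoundary θ r K))
    (hP : ∀ z ∈ chainBoundary θ r K, HasDerivAt P (g z) z) : contourInt θ r K g = 0 := by
  rw [contourInt_of_primitives hr hθ hK hg (fun z hz _ => hP z hz) (fun z hz _ => hP z hz)
    (by simp)]
  simp

theorem contourInt_of_differentiableOn [CompleteSpace E] (hr : 0 < r)
    (hθ : ∀ i j, i < j → j < K → θ i < θ j) (hK : 0 < K) {ρ : ℝ} (hρ : r < ρ) {h : ℂ → E}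
    (hh : DifferentiableOn ℂ h (diskChain θ ρ K)) : contourInt θ r K h = 0 := by
  obtain ⟨P, hP⟩ := exists_primitive_diskChain hθ hh
  have hsub := chainBoundary_subset_diskChain (θ := θ) (K := K) hρ
  exact contourInt_eq_zero hr hθ hK (hh.continuousOn.mono hsub) fun z hz => hP z (hsub hz)

theorem sub_ne_zero_of_mem_chainBoundary {a : ℂ} (ha : a ∈ diskChain θ r K) {z : ℂ}
    (hz : z ∈ chainBoundary θ r K) : z - a ≠ 0 := by
  intro h
  rw [sub_eq_zero] at h
  subst h
  obtain ⟨i, hi, h⟩ := ha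
  exact absurd (hz.2 i hi) (not_le.2 h)

theorem contourInt_inv_sub_sq (hr : 0 < r)
    (hθ : ∀ i j, i < j → j < K → θ i < θ j) (hK : 0 < K) {a : ℂ} (ha : a ∈ diskChain θ r K) :
    contourInt θ r K (fun z => ((z - a) ^ 2)⁻¹) = 0 := by
  have hne := fun z hz => sub_ne_zero_of_mem_chainBoundary (z := z) ha hz
  refine contourInt_eq_zero hr hθ hK (P := fun z => -(z - a)⁻¹) ?_ fun z hz => ?_
  · exact ContinuousOn.inv₀ (by fun_prop) fun z hz => pow_ne_zero 2 (hne z hz)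
  · have := (((hasDerivAt_id' z).sub_const a).inv (hne z hz)).neg
    convert this using 1
    · rfl
    · rw [neg_div, neg_neg, one_div]

/-- The primitives are log(-i(z - a)), cut downwards from a, on the upper half and log(i(z - a)),
cut upwards, on the lower half. Their difference on the real axis is πi left of a and -πi right of
it, which gives 2πi in total. As a lies inside a disk, no gap contains it, so the difference agrees
at both ends of each gap. -/
theorem contourInt_inv_sub (hr : 0 < r)
    (hθ : ∀ i j, i < j → j < K → θ i < θ j) (hK : 0 < K) {a : ℝ}
    (ha : (a : ℂ) ∈ diskChain θ r K) :
    contourInt θ r K (fun z => (z - a)⁻¹) = 1 := by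
  have hne := fun z hz => sub_ne_zero_of_mem_chainBoundary (z := z) ha hz
  have hcont : ContinuousOn (fun z : ℂ => (z - a)⁻¹) (chainBoundary θ r K) :=
    ContinuousOn.inv₀ (by fun_prop) hne
  have hlog : ∀ (s z : ℂ), s ≠ 0 → s * (z - a) ∈ Complex.slitPlane →
      HasDerivAt (fun w => Complex.log (s * (w - a))) (z - a)⁻¹ z := by
    intro s z hs hz
    have := (((hasDerivAt_id' z).sub_const (a : ℂ)).const_mul s).clog hz
    convert this using 1
    rw [mul_one, ← div_div, div_self hs, one_div]
  have hpos : ∀ x : ℝ, a < x → Complex.log (-Complex.I * ((x : ℂ) - a)) -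
      Complex.log (Complex.I * ((x : ℂ) - a)) = -(π * Complex.I) := by
    intro x hx
    have h0 : (0 : ℝ) < x - a := by linarith
    rw [← Complex.ofReal_sub, mul_comm, Complex.log_ofReal_mul h0 (by simp), mul_comm,
      Complex.log_ofReal_mul h0 (by simp), Complex.log_neg_I, Complex.log_I]
    ring
  have hneg : ∀ x : ℝ, x < a → Complex.log (-Complex.I * ((x : ℂ) - a)) -
      Complex.log (Complex.I * ((x : ℂ) - a)) = π * Complex.I := by
    intro x hx
    have h0 : (0 : ℝ) < a - x := by linarith
    have e1 : -Complex.I * ((x : ℂ) - a) = ((a - x : ℝ) : ℂ) * Complex.I := by push_cast; ring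
    have e2 : Complex.I * ((x : ℂ) - a) = ((a - x : ℝ) : ℂ) * -Complex.I := by push_cast; ring
    rw [e1, e2, Complex.log_ofReal_mul h0 (by simp),
      Complex.log_ofReal_mul h0 (by simp), Complex.log_neg_I, Complex.log_I]
    ring
  obtain ⟨m, hm, ham⟩ := ha
  rw [← Complex.ofReal_sub, Complex.norm_real, norm_eq_abs, abs_lt] at ham
  have hmono : ∀ k l, k ≤ l → l < K → θ k ≤ θ l := fun k l hkl hl => by
    rcases hkl.lt_or_eq with h | rfl
    exacts [(hθ k l h hl).le, le_rfl]
  rw [contourInt_of_primitives hr hθ hK hcont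
    (P := fun w => Complex.log (-Complex.I * (w - a)))
    (Q := fun w => Complex.log (Complex.I * (w - a))) ?_ ?_ ?_]
  · have h1 := hmono 0 m (by omega) hm
    have h2 := hmono m (K - 1) (by omega) (by omega)
    rw [hneg _ (by linarith), hpos _ (by linarith), smul_eq_mul]
    have hpi : (π : ℂ) ≠ 0 := by exact_mod_cast pi_ne_zero
    have hI := Complex.I_ne_zero
    field_simp
    ring
  · intro z hz him
    refine hlog _ z (by simp) ?_
    have h := hne z hz
    rw [Complex.mem_slitPlane_iff]
    by_cases h0 : z.im = 0
    · right
      simp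
      intro h1
      refine h (Complex.ext ?_ (by simpa using h0))
      rw [Complex.sub_re, Complex.ofReal_re, Complex.zero_re]
      linarith
    · left
      simp
      exact lt_of_le_of_ne him (Ne.symm h0)
  · intro z hz him
    refine hlog _ z (by simp) ?_
    have h := hne z hz
    rw [Complex.mem_slitPlane_iff]
    by_cases h0 : z.im = 0
    · right
      simp
      intro h1
      refine h (Complex.ext ?_ (by simpa using h0))
      rw [Complex.sub_re, Complex.ofReal_re, Complex.zero_re]
      linarith
    · left
      simp
      exact lt_of_le_of_ne him h0
  · intro i hi hle
    rcases le_or_gt m i with h | h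
    · have := hmono m i h (by omega)
      rw [hpos _ (by linarith), hpos _ (by linarith)]
    · have := hmono (i + 1) m h hm
      rw [hneg _ (by linarith), hneg _ (by linarith)]

/-- Cauchy's integral formula. -/
theorem contourInt_inv_sub_smul [CompleteSpace E] (hr : 0 < r)
    (hθ : ∀ i j, i < j → j < K → θ i < θ j) (hK : 0 < K) {ρ : ℝ} (hρ : r < ρ) {h : ℂ → E}
    (hh : DifferentiableOn ℂ h (diskChain θ ρ K)) {a : ℝ} (ha : (a : ℂ) ∈ diskChain θ r K) :
    contourInt θ r K (fun z => (z - a)⁻¹ • h z) = h a := by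
  have hsub := chainBoundary_subset_diskChain (θ := θ) (K := K) hρ
  have hne := fun z hz => sub_ne_zero_of_mem_chainBoundary (z := z) ha hz
  have haρ : (a : ℂ) ∈ diskChain θ ρ K := by
    obtain ⟨i, hi, h⟩ := ha
    exact ⟨i, hi, h.trans hρ⟩
  -- The difference quotient has a removable singularity at a, so h(z)/(z - a) is h(a)/(z - a) plus
  -- a holomorphic function with vanishing integral.
  have hd : DifferentiableOn ℂ (dslope h a) (diskChain θ ρ K) :=
    (Complex.differentiableOn_dslope (isOpen_diskChain.mem_nhds haρ)).2 hh
  have heq : EqOn (fun z : ℂ => (z - a)⁻¹ • h z) (fun z : ℂ => (z - a)⁻¹ • h a + dslope h a z)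
      (chainBoundary θ r K) := fun z hz => by
    have := hne z hz
    simp only
    rw [dslope_of_ne _ (sub_ne_zero.1 this), slope_def_module, smul_sub]
    abel
  rw [contourInt_congr hr hθ heq, contourInt_add hr hθ (g₁ := fun z => (z - a)⁻¹ • h a)
    ((ContinuousOn.inv₀ (by fun_prop) hne).smul continuousOn_const) (hd.continuousOn.mono hsub),
    contourInt_of_differentiableOn hr hθ hK hρ hd, contourInt_smul_const,
    contourInt_inv_sub hr hθ hK ha, one_smul, add_zero]

/-- Partial fractions reduce the two distinct poles to Cauchy's formula at each of them. -/
theorem contourInt_inv_mul_inv_smul [CompleteSpace E] (hr : 0 < r)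
    (hθ : ∀ i j, i < j → j < K → θ i < θ j) (hK : 0 < K) {ρ : ℝ} (hρ : r < ρ) {h : ℂ → E}
    (hh : DifferentiableOn ℂ h (diskChain θ ρ K)) {a b : ℝ} (ha : (a : ℂ) ∈ diskChain θ r K)
    (hb : (b : ℂ) ∈ diskChain θ r K) (hab : a ≠ b) :
    contourInt θ r K (fun z => ((z - a)⁻¹ * (z - b)⁻¹) • h z) =
      ((b : ℂ) - a)⁻¹ • (h b - h a) := by
  have hsub := chainBoundary_subset_diskChain (θ := θ) (K := K) hρ
  have hna := fun z hz => sub_ne_zero_of_mem_chainBoundary (z := z) ha hz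
  have hnb := fun z hz => sub_ne_zero_of_mem_chainBoundary (z := z) hb hz
  have hba : (b : ℂ) - a ≠ 0 := by
    rw [← Complex.ofReal_sub]; exact_mod_cast sub_ne_zero.2 hab.symm
  have hc := hh.continuousOn.mono hsub
  have heq : EqOn (fun z : ℂ => ((z - a)⁻¹ * (z - b)⁻¹) • h z)
      (fun z : ℂ => ((b : ℂ) - a)⁻¹ • ((z - b)⁻¹ • h z - (z - a)⁻¹ • h z))
      (chainBoundary θ r K) := fun z hz => by
    have h1 := hna z hz
    have h2 := hnb z hz
    simp only
    rw [← sub_smul, smul_smul]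
    congr 1
    field_simp
    ring
  rw [contourInt_congr hr hθ heq, contourInt_smul, contourInt_sub hr hθ
    (g₁ := fun z => (z - b)⁻¹ • h z) (g₂ := fun z => (z - a)⁻¹ • h z)
    ((ContinuousOn.inv₀ (by fun_prop) hnb).smul hc)
    ((ContinuousOn.inv₀ (by fun_prop) hna).smul hc),
    contourInt_inv_sub_smul hr hθ hK hρ hh ha, contourInt_inv_sub_smul hr hθ hK hρ hh hb]

/-- Splitting off h(a)/(z - a)², which has a single-valued primitive, leaves a simple pole with
numerator `dslope h a`, whose value at a is the derivative. -/
theorem contourInt_inv_sq_smul [CompleteSpace E] (hr : 0 < r)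
    (hθ : ∀ i j, i < j → j < K → θ i < θ j) (hK : 0 < K) {ρ : ℝ} (hρ : r < ρ) {h : ℂ → E}
    (hh : DifferentiableOn ℂ h (diskChain θ ρ K)) {a : ℝ} (ha : (a : ℂ) ∈ diskChain θ r K) :
    contourInt θ r K (fun z => ((z - a)⁻¹ * (z - a)⁻¹) • h z) = deriv h a := by
  have hsub := chainBoundary_subset_diskChain (θ := θ) (K := K) hρ
  have hne := fun z hz => sub_ne_zero_of_mem_chainBoundary (z := z) ha hz
  have haρ : (a : ℂ) ∈ diskChain θ ρ K := by
    obtain ⟨i, hi, h⟩ := ha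
    exact ⟨i, hi, h.trans hρ⟩
  have hd : DifferentiableOn ℂ (dslope h a) (diskChain θ ρ K) :=
    (Complex.differentiableOn_dslope (isOpen_diskChain.mem_nhds haρ)).2 hh
  have hinv : ContinuousOn (fun z : ℂ => (z - a)⁻¹) (chainBoundary θ r K) :=
    ContinuousOn.inv₀ (by fun_prop) hne
  have heq : EqOn (fun z : ℂ => ((z - a)⁻¹ * (z - a)⁻¹) • h z)
      (fun z : ℂ => ((z - a) ^ 2)⁻¹ • h a + (z - a)⁻¹ • dslope h a z)
      (chainBoundary θ r K) := fun z hz => by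
    have := hne z hz
    simp only
    rw [dslope_of_ne _ (sub_ne_zero.1 this), slope_def_module, smul_smul, smul_sub, pow_two,
      mul_inv]
    abel
  rw [contourInt_congr hr hθ heq, contourInt_add hr hθ
    (g₁ := fun z => ((z - a) ^ 2)⁻¹ • h a) (g₂ := fun z => (z - a)⁻¹ • dslope h a z)
    ((ContinuousOn.inv₀ (by fun_prop) fun z hz => pow_ne_zero 2 (hne z hz)).smul
      continuousOn_const) (hinv.smul (hd.continuousOn.mono hsub)),
    contourInt_inv_sub_smul hr hθ hK hρ hd ha, contourInt_smul_const,
    contourInt_inv_sub_sq hr hθ hK ha, zero_smul, zero_add, dslope_same]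

end Cauchy


/-! ### Eigenvectors, the spectral gap and Weyl's inequality -/

section SpectralFacts

variable {H : Type*} [NormedAddCommGroup H] [InnerProductSpace ℝ H]
  {T That : H →L[ℝ] H} {lam lamhat : SpecIndex H → ℝ} {ψ ψhat : SpecIndex H → H}

theorem eigProj_apply (ψ : SpecIndex H → H) (k : SpecIndex H) (v : H) :
    eigProj ψ k v = ⟪ψ k, v⟫_ℝ • ψ k := rfl

theorem eigProj_apply_self (hψ : Orthonormal ℝ ψ) (k : SpecIndex H) :
    eigProj ψ k (ψ k) = ψ k := by
  rw [eigProj_apply, real_inner_self_eq_norm_sq, hψ.1]; simp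

theorem eigProj_apply_of_ne (hψ : Orthonormal ℝ ψ) {k l : SpecIndex H} (h : k ≠ l) :
    eigProj ψ k (ψ l) = 0 := by
  rw [eigProj_apply, hψ.2 h, zero_smul]

theorem IsEigenDecomposition.hasSum_apply (h : IsEigenDecomposition T lam ψ) (v : H) :
    HasSum (fun k => lam k • eigProj ψ k v) (T v) :=
  h.hasSum.mapL (ContinuousLinearMap.apply ℝ H v)

theorem IsEigenDecomposition.apply_self (h : IsEigenDecomposition T lam ψ) (k : SpecIndex H) :
    T (ψ k) = lam k • ψ k := by
  refine (h.hasSum_apply (ψ k)).unique ?_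
  have := hasSum_single (f := fun l => lam l • eigProj ψ l (ψ k)) k fun l hl => by
    rw [eigProj_apply_of_ne h.orthonormal hl, smul_zero]
  rwa [eigProj_apply_self h.orthonormal] at this

theorem IsEigenDecomposition.apply_of_orthogonal (h : IsEigenDecomposition T lam ψ) {v : H}
    (hv : ∀ k, ⟪ψ k, v⟫_ℝ = 0) : T v = 0 := by
  refine (h.hasSum_apply v).unique ?_
  simp only [eigProj_apply, hv, zero_smul, smul_zero]
  exact hasSum_zero

theorem mem_span_range_orthogonal_iff {v : H} :
    v ∈ (Submodule.span ℝ (Set.range ψ))ᗮ ↔ ∀ k, ⟪ψ k, v⟫_ℝ = 0 := by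
  refine ⟨fun h k => (Submodule.mem_orthogonal _ _).1 h _ (Submodule.subset_span ⟨k, rfl⟩),
    fun h => (Submodule.mem_orthogonal _ _).2 fun u hu => ?_⟩
  induction hu using Submodule.span_induction with
  | mem x hx => obtain ⟨k, rfl⟩ := hx; exact h k
  | zero => simp
  | add x y _ _ hx hy => rw [inner_add_left, hx, hy, add_zero]
  | smul c x _ hx => rw [inner_smul_left, hx, mul_zero]

/-- An orthonormal system indexed by `SpecIndex H` with a non-zero orthogonal vector forces `H` to
be infinite-dimensional. -/
theorem infinite_of_orthogonal (hψ : Orthonormal ℝ ψ) {v : H} (hv0 : v ≠ 0)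
    (hv : ∀ k, ⟪ψ k, v⟫_ℝ = 0) : Infinite (SpecIndex H) := by
  by_contra hfin
  rw [not_infinite_iff_finite] at hfin
  have hrank : Module.rank ℝ H < Cardinal.aleph0 := by
    by_contra hge
    rw [not_lt] at hge
    have hinj : Function.Injective
        (fun k : ℕ => (⟨k, (Cardinal.natCast_lt_aleph0).trans_le hge⟩ : SpecIndex H)) :=
      fun a b hab => congrArg Subtype.val hab
    exact Set.infinite_univ.not_finite (Set.finite_univ_iff.2 (Finite.of_injective _ hinj))
  have : Module.Finite ℝ H := Module.rank_lt_aleph0_iff.1 hrank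
  have hn := Module.finrank_eq_rank ℝ H
  let e : SpecIndex H ≃ Fin (Module.finrank ℝ H) :=
    { toFun := fun k => ⟨k.1, Nat.cast_lt.1 (k.2.trans_eq hn.symm)⟩
      invFun := fun i => ⟨i.1, by rw [← hn]; exact_mod_cast i.2⟩
      left_inv := fun k => rfl
      right_inv := fun i => rfl }
  have : Fintype (SpecIndex H) := Fintype.ofEquiv _ e.symm
  have hcard : Fintype.card (SpecIndex H) = Module.finrank ℝ H := by
    rw [Fintype.card_congr e, Fintype.card_fin]
  -- The index set has exactly dim H elements, so a finite orthonormal family indexed by it spans H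
  -- and leaves no room for `v`.
  have hspan := hψ.linearIndependent.span_eq_top_of_card_eq_finrank' hcard
  have hmem := mem_span_range_orthogonal_iff.2 hv
  rw [hspan, Submodule.top_orthogonal_eq_bot, Submodule.mem_bot] at hmem
  exact hv0 hmem

theorem gap_le {J : Finset (SpecIndex H)} {k l : SpecIndex H} (hk : k ∈ J) (hl : l ∉ J) :
    gap lam J ≤ |lam k - lam l| :=
  csInf_le ⟨0, by rintro _ ⟨k, _, l, _, rfl⟩; exact abs_nonneg _⟩ ⟨k, hk, l, hl, rfl⟩

/-- The terms of a convergent series tend to zero in norm, so the eigenvalues tend to 0 and |λ_k -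
λ_l| tends to λ_k. This separates J from the eigenvalue 0 on the residual space. -/
theorem IsEigenDecomposition.gap_le_of_infinite (h : IsEigenDecomposition T lam ψ)
    {J : Finset (SpecIndex H)} (hinf : Infinite (SpecIndex H)) {k : SpecIndex H} (hk : k ∈ J) :
    gap lam J ≤ lam k := by
  have h0 := h.hasSum.summable.tendsto_cofinite_zero.norm
  have hnorm : ∀ l, ‖lam l • eigProj ψ l‖ = lam l := fun l => by
    rw [norm_smul, eigProj, InnerProductSpace.norm_rankOne, h.orthonormal.1,
      Real.norm_of_nonneg (h.nonneg l)]
    simp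
  simp only [hnorm, norm_zero] at h0
  have h1 : Filter.Tendsto (fun l => |lam k - lam l|) Filter.cofinite (nhds |lam k - 0|) :=
    (tendsto_const_nhds.sub h0).abs
  rw [sub_zero, abs_of_nonneg (h.nonneg k)] at h1
  refine ge_of_tendsto h1 ?_
  filter_upwards [J.finite_toSet.compl_mem_cofinite] with l hl
  exact gap_le hk hl

/-- One half of Weyl's perturbation inequality for eigenvalues. -/
theorem IsEigenDecomposition.le_add_norm_sub (h : IsEigenDecomposition T lam ψ)
    (hhat : IsEigenDecomposition That lamhat ψhat) (k : SpecIndex H) :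
    lam k ≤ lamhat k + ‖That - T‖ := by
  let ι : Fin (k.1 + 1) → SpecIndex H := fun i =>
    ⟨i.1, lt_of_le_of_lt (by exact_mod_cast Nat.lt_succ_iff.1 i.2) k.2⟩
  have hι : Function.Injective ι := fun a b hab => Fin.ext (congrArg (fun x => x.1) hab)
  have hιk : ∀ i, ι i ≤ k := fun i => Nat.lt_succ_iff.1 i.2
  have hon : Orthonormal ℝ (ψ ∘ ι) := h.orthonormal.comp ι hι
  let κ : Fin k.1 → SpecIndex H := fun i => ι i.castSucc
  let F : (Fin (k.1 + 1) → ℝ) →ₗ[ℝ] (Fin k.1 → ℝ) :=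
    LinearMap.pi fun j => (innerSL ℝ (ψhat (κ j))).toLinearMap ∘ₗ
      Fintype.linearCombination ℝ (ψ ∘ ι)
  -- Dimension count as in the Courant–Fischer principle: the span of the first k + 1 vectors ψ
  -- contains a non-zero x orthogonal to the first k vectors ψhat.
  obtain ⟨c, hcF, hc0⟩ := (Submodule.ne_bot_iff _).1
    (LinearMap.ker_ne_bot_of_finrank_lt (f := F) (by simp))
  set x : H := ∑ i, c i • ψ (ι i) with hx
  have horth : ∀ j : SpecIndex H, j < k → ⟪ψhat j, x⟫_ℝ = 0 := by
    intro j hj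
    have := congrFun (LinearMap.mem_ker.1 hcF) ⟨j.1, hj⟩
    simpa [F, κ, ι, Fintype.linearCombination_apply] using this
  have hxx : ⟪x, x⟫_ℝ = ∑ i, c i * c i := by
    have := hon.inner_sum c c Finset.univ
    simpa [hx] using this
  have hTx : ⟪T x, x⟫_ℝ = ∑ i, lam (ι i) * (c i * c i) := by
    have hTx' : T x = ∑ i, (c i * lam (ι i)) • ψ (ι i) := by
      rw [hx, map_sum]
      refine Finset.sum_congr rfl fun i _ => ?_
      rw [map_smul, h.apply_self, smul_smul]
    have := hon.inner_sum (fun i => c i * lam (ι i)) c Finset.univ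
    rw [hTx', hx]
    simp only [Function.comp_apply] at this
    rw [this]
    exact Finset.sum_congr rfl fun i _ => by simp; ring
  have hxpos : 0 < ⟪x, x⟫_ℝ := by
    rw [hxx]
    obtain ⟨i, hi⟩ := Function.ne_iff.1 hc0
    exact Finset.sum_pos' (fun i _ => mul_self_nonneg _)
      ⟨i, Finset.mem_univ _, mul_self_pos.2 hi⟩
  have hlow : lam k * ⟪x, x⟫_ℝ ≤ ⟪T x, x⟫_ℝ := by
    rw [hxx, hTx, Finset.mul_sum]
    exact Finset.sum_le_sum fun i _ =>
      mul_le_mul_of_nonneg_right (h.antitone (hιk i)) (mul_self_nonneg _)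
  -- Terms with j < k vanish by orthogonality and the others have a factor at most `lamhat k`; since
  -- this is non-negative, Bessel's inequality suffices.
  have hhigh : ⟪That x, x⟫_ℝ ≤ lamhat k * ⟪x, x⟫_ℝ := by
    have h1 : HasSum (fun j => ⟪x, lamhat j • eigProj ψhat j x⟫_ℝ) ⟪x, That x⟫_ℝ :=
      (hhat.hasSum_apply x).mapL (innerSL ℝ x)
    have h2 := (hhat.orthonormal.inner_products_summable (x := x)).hasSum.mul_left (lamhat k)
    rw [real_inner_comm]
    have hle := hasSum_le (fun j => ?_) h1 h2
    · refine hle.trans (mul_le_mul_of_nonneg_left ?_ (hhat.nonneg k))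
      rw [real_inner_self_eq_norm_sq]
      exact hhat.orthonormal.tsum_inner_products_le x
    · rw [eigProj_apply, inner_smul_right, inner_smul_right, real_inner_comm (ψhat j) x,
        Real.norm_eq_abs, sq_abs]
      rcases lt_or_ge j k with hjk | hjk
      · rw [horth j hjk]; simp
      · rw [← pow_two]
        exact mul_le_mul_of_nonneg_right (hhat.antitone hjk) (sq_nonneg _)
  have hE : ⟪T x, x⟫_ℝ - ⟪That x, x⟫_ℝ ≤ ‖That - T‖ * ⟪x, x⟫_ℝ := by
    rw [← inner_sub_left, ← sub_apply, real_inner_self_eq_norm_sq]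
    calc _ ≤ ‖(T - That) x‖ * ‖x‖ := real_inner_le_norm _ _
      _ ≤ (‖T - That‖ * ‖x‖) * ‖x‖ := by gcongr; exact ContinuousLinearMap.le_opNorm _ _
      _ = ‖That - T‖ * ‖x‖ ^ 2 := by rw [norm_sub_rev]; ring
  refine le_of_mul_le_mul_right ?_ hxpos
  linarith [add_mul (lamhat k) ‖That - T‖ ⟪x, x⟫_ℝ]

/-- Weyl's perturbation inequality for eigenvalues. -/
theorem IsEigenDecomposition.abs_sub_le (h : IsEigenDecomposition T lam ψ)
    (hhat : IsEigenDecomposition That lamhat ψhat) (k : SpecIndex H) :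
    |lamhat k - lam k| ≤ ‖That - T‖ := by
  have h1 := h.le_add_norm_sub hhat k
  have h2 := hhat.le_add_norm_sub h k
  rw [norm_sub_rev] at h2
  rw [abs_le]
  constructor <;> linarith

end SpectralFacts

/-! ### Diagonal operators, displaced eigenvalues and resolvent bounds -/

section Diagonal

variable {H : Type*} [NormedAddCommGroup H] [InnerProductSpace ℝ H]
  {T A : H →L[ℝ] H} {lam μ : SpecIndex H → ℝ} {ψ : SpecIndex H → H}

/-- `A` has the eigenvectors `ψ k` with eigenvalues `μ k`, and vanishes on their orthogonal
complement. -/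
structure IsDiagonal (A : H →L[ℝ] H) (μ : SpecIndex H → ℝ) (ψ : SpecIndex H → H) : Prop where
  apply_self : ∀ k, A (ψ k) = μ k • ψ k
  apply_of_orthogonal : ∀ v, (∀ k, ⟪ψ k, v⟫_ℝ = 0) → A v = 0

theorem IsEigenDecomposition.isDiagonal (h : IsEigenDecomposition T lam ψ) :
    IsDiagonal T lam ψ :=
  ⟨h.apply_self, fun _ hv => h.apply_of_orthogonal hv⟩

/-- The operator obtained from `T` by moving the eigenvalues with index in `J` to `s`. -/
noncomputable def moveEig (T : H →L[ℝ] H) (lam : SpecIndex H → ℝ) (ψ : SpecIndex H → H)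
    (J : Finset (SpecIndex H)) (s : ℝ) : H →L[ℝ] H :=
  T + ∑ k ∈ J, (s - lam k) • eigProj ψ k

open Classical in
theorem IsDiagonal.isDiagonal_moveEig (h : IsDiagonal T lam ψ) (hψ : Orthonormal ℝ ψ)
    (J : Finset (SpecIndex H)) (s : ℝ) :
    IsDiagonal (moveEig T lam ψ J s) (fun k => if k ∈ J then s else lam k) ψ := by
  constructor
  · intro k
    have : ∀ l ∈ J, ((s - lam l) • eigProj ψ l) (ψ k) = if k = l then (s - lam k) • ψ k else 0 := by
      intro l _
      rw [smul_apply]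
      split_ifs with hkl
      · rw [← hkl, eigProj_apply_self hψ]
      · rw [eigProj_apply_of_ne hψ (Ne.symm hkl), smul_zero]
    rw [moveEig, add_apply, sum_apply,
      Finset.sum_congr rfl this, Finset.sum_ite_eq, h.apply_self]
    split_ifs
    · rw [← add_smul]; congr 1; ring
    · rw [add_zero]
  · intro v hv
    rw [moveEig, add_apply, sum_apply,
      h.apply_of_orthogonal v hv, zero_add]
    exact Finset.sum_eq_zero fun l _ => by
      rw [smul_apply, eigProj_apply, hv, zero_smul, smul_zero]

variable [CompleteSpace H]

theorem exists_hilbertBasis_extension_family (hψ : Orthonormal ℝ ψ) :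
    ∃ (w : Set H) (b : HilbertBasis w ℝ H), ∀ i, (∃ k, b i = ψ k) ∨
      (b i ≠ 0 ∧ ∀ k, ⟪ψ k, b i⟫_ℝ = 0) := by
  obtain ⟨w, b, hw, hb⟩ := hψ.toSubtypeRange.exists_hilbertBasis_extension
  refine ⟨w, b, fun i => ?_⟩
  by_cases hi : ∃ k, b i = ψ k
  · exact Or.inl hi
  · refine Or.inr ⟨b.orthonormal.ne_zero i, fun k => ?_⟩
    have hk : ψ k ∈ w := hw ⟨k, rfl⟩
    have h1 : b ⟨ψ k, hk⟩ = ψ k := by rw [hb]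
    rw [← h1]
    refine b.orthonormal.2 fun h => hi ⟨k, ?_⟩
    rw [← h1, h]

/-- The ψ_k extend to a Hilbert basis of eigenvectors. An added vector has eigenvalue 0 and can
exist only when the index set is infinite, so `p 0` is demanded only then. -/
theorem IsDiagonal.exists_eigenvalue (hA : IsDiagonal A μ ψ) (hψ : Orthonormal ℝ ψ) {p : ℝ → Prop}
    (hp : ∀ k, p (μ k)) (hp0 : Infinite (SpecIndex H) → p 0) :
    ∃ (w : Set H) (b : HilbertBasis w ℝ H), ∀ i, ∃ m : ℝ, A (b i) = m • b i ∧ p m := by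
  obtain ⟨w, b, hb⟩ := exists_hilbertBasis_extension_family hψ
  refine ⟨w, b, fun i => ?_⟩
  rcases hb i with ⟨k, hk⟩ | ⟨h0, hk⟩
  · exact ⟨μ k, by rw [hk, hA.apply_self], hp k⟩
  · exact ⟨0, by rw [hA.apply_of_orthogonal _ hk, zero_smul], hp0 (infinite_of_orthogonal hψ h0 hk)⟩

theorem IsDiagonal.mem_resolventSet_real (hA : IsDiagonal A μ ψ) (hψ : Orthonormal ℝ ψ) {t d : ℝ}
    (hd : 0 < d) (hp : ∀ k, d ≤ |t - μ k|) (hp0 : Infinite (SpecIndex H) → d ≤ |t|) :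
    t ∈ resolventSet ℝ A := by
  obtain ⟨w, b, hb⟩ := hA.exists_eigenvalue hψ (p := fun m => d ≤ |t - m|) hp (by simpa using hp0)
  refine isUnit_of_hilbertBasis b _ hd fun i => ?_
  obtain ⟨m, hm, hdm⟩ := hb i
  refine ⟨t - m, ?_, hdm⟩
  rw [sub_apply, hm, Algebra.algebraMap_eq_smul_one, sub_smul]
  simp

theorem IsDiagonal.resolvent_bound (hA : IsDiagonal A μ ψ) (hψ : Orthonormal ℝ ψ) {z : ℂ} {d : ℝ}
    (hd : 0 < d) (hp : ∀ k, d ≤ ‖z - μ k‖) (hp0 : Infinite (SpecIndex H) → d ≤ ‖z‖) :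
    z ∈ resolventSet ℂ (complexify A) ∧ ‖resolvent (complexify A) z‖ ≤ d⁻¹ := by
  obtain ⟨w, b, hb⟩ := hA.exists_eigenvalue hψ (p := fun m => d ≤ ‖z - m‖) hp (by simpa using hp0)
  obtain ⟨B, hB⟩ := exists_hilbertBasis_complexification b
  have key : ∀ i, ∃ m : ℂ, (algebraMap ℂ (Complexification H →L[ℂ] Complexification H) z -
      complexify A) (B i) = m • B i ∧ d ≤ ‖m‖ := by
    intro i
    obtain ⟨m, hm, hdm⟩ := hb i
    refine ⟨z - m, ?_, hdm⟩
    have : complexify A (B i) = (m : ℂ) • B i := by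
      rw [hB]
      ext
      · rw [re_complexify, Complexification.re_mk, hm]; simp [-Complex.coe_smul]
      · rw [im_complexify, Complexification.im_mk]; simp [-Complex.coe_smul]
    rw [sub_apply, this, Algebra.algebraMap_eq_smul_one, sub_smul]
    simp [-Complex.coe_smul]
  exact ⟨isUnit_of_hilbertBasis B _ hd key, norm_inverse_le_of_hilbertBasis B _ hd key⟩

end Diagonal

/-! ### Polar and holomorphic parts of the resolvent -/

section Riesz

variable {H : Type*} [NormedAddCommGroup H] [InnerProductSpace ℝ H] [CompleteSpace H]
  {T : H →L[ℝ] H} {lam : SpecIndex H → ℝ} {ψ : SpecIndex H → H}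

theorem IsDiagonal.mul_eigProj (h : IsDiagonal T lam ψ) (k : SpecIndex H) :
    T * eigProj ψ k = lam k • eigProj ψ k := by
  ext v
  rw [mul_apply_eq_comp, eigProj_apply, map_smul, h.apply_self, smul_comm]
  rfl

theorem IsDiagonal.eigProj_mul (h : IsDiagonal T lam ψ) (hT : IsSelfAdjoint T) (k : SpecIndex H) :
    eigProj ψ k * T = lam k • eigProj ψ k := by
  ext v
  have := hT.isSymmetric (ψ k) v
  simp only [ContinuousLinearMap.coe_coe, h.apply_self, inner_smul_left] at this
  simp [eigProj_apply, ← this, smul_smul]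

open Classical in
theorem eigProj_mul_eigProj (hψ : Orthonormal ℝ ψ) (k l : SpecIndex H) :
    eigProj ψ k * eigProj ψ l = if k = l then eigProj ψ k else 0 := by
  ext v
  rw [mul_apply_eq_comp, eigProj_apply ψ l, map_smul]
  split_ifs with h
  · rw [← h, eigProj_apply_self hψ, eigProj_apply]
  · rw [eigProj_apply_of_ne hψ h, smul_zero]; rfl

theorem eigProj_mul_one_sub_sum (hψ : Orthonormal ℝ ψ) {J : Finset (SpecIndex H)}
    {k : SpecIndex H} (hk : k ∈ J) : eigProj ψ k * (1 - ∑ l ∈ J, eigProj ψ l) = 0 := by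
  classical
  rw [mul_sub, mul_one, Finset.mul_sum]
  simp [eigProj_mul_eigProj hψ, hk]

theorem commute_eigProj_moveEig (h : IsDiagonal T lam ψ) (hψ : Orthonormal ℝ ψ)
    (hT : IsSelfAdjoint T) (J : Finset (SpecIndex H)) (s : ℝ) (k : SpecIndex H) :
    Commute (eigProj ψ k) (moveEig T lam ψ J s) := by
  classical
  refine Commute.add_right ?_ (Commute.sum_right _ _ _ fun l _ => Commute.smul_right ?_ _)
  · exact (h.eigProj_mul hT k).trans (h.mul_eigProj k).symm
  · change _ = _
    rw [eigProj_mul_eigProj hψ, eigProj_mul_eigProj hψ]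
    by_cases hkl : k = l
    · simp [hkl]
    · simp [hkl, Ne.symm hkl]

/-- Splitting of the resolvent into the eigenvalues with index in `J` and a remainder. -/
theorem IsDiagonal.resolvent_eq (h : IsDiagonal T lam ψ) (hψ : Orthonormal ℝ ψ)
    (hT : IsSelfAdjoint T) (J : Finset (SpecIndex H)) (s : ℝ) {z : ℂ}
    (hz : z ∈ resolventSet ℂ (complexify T))
    (hz₁ : z ∈ resolventSet ℂ (complexify (moveEig T lam ψ J s)))
    (hne : ∀ k ∈ J, z - lam k ≠ 0) :
    resolvent (complexify T) z = ∑ k ∈ J, (z - lam k)⁻¹ • complexify (eigProj ψ k) +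
      resolvent (complexify (moveEig T lam ψ J s)) z *
        complexify (1 - ∑ k ∈ J, eigProj ψ k) := by
  set p := complexify (1 - ∑ k ∈ J, eigProj ψ k) with hp
  set R₁ := resolvent (complexify (moveEig T lam ψ J s)) z with hR₁
  set Z := algebraMap ℂ (Complexification H →L[ℂ] Complexification H) z with hZ
  have hu : IsUnit (Z - complexify T) := hz
  have hu₁ : IsUnit (Z - complexify (moveEig T lam ψ J s)) := hz₁
  have hmul₁ : (Z - complexify (moveEig T lam ψ J s)) * R₁ = 1 := Ring.mul_inverse_cancel _ hu₁
  -- Q_k commutes with R₁ and annihilates p. Hence the finite-rank difference between T and the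
  -- displaced operator does not act on R₁ p.
  have hq : ∀ k ∈ J, complexify (eigProj ψ k) * (R₁ * p) = 0 := by
    intro k hk
    have hc : Commute (complexify (eigProj ψ k)) (Z - complexify (moveEig T lam ψ J s)) := by
      refine Commute.sub_right (Algebra.commutes _ _).symm ?_
      exact (commute_eigProj_moveEig h hψ hT J s k).map complexifyHom
    have hc' : Commute (complexify (eigProj ψ k)) R₁ := by
      obtain ⟨u, hu⟩ := hu₁
      rw [← hu] at hc
      rw [hR₁, resolvent, ← hu, Ring.inverse_unit]
      exact hc.units_inv_right
    rw [← mul_assoc, hc'.eq, mul_assoc, hp, ← complexify_mul, eigProj_mul_one_sub_sum hψ hk]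
    exact (congrArg _ (map_zero complexifyHom)).trans (mul_zero _)
  -- The claimed expression is a right inverse of z - T; since z - T is invertible, it is the
  -- resolvent.
  have hright : (Z - complexify T) * (∑ k ∈ J, (z - lam k)⁻¹ • complexify (eigProj ψ k) + R₁ * p)
      = 1 := by
    have h1 : ∀ k ∈ J, (Z - complexify T) * ((z - lam k)⁻¹ • complexify (eigProj ψ k)) =
        complexify (eigProj ψ k) := by
      intro k hk
      rw [mul_smul_comm, sub_mul, ← complexify_mul, h.mul_eigProj, complexify_smul, hZ,
        Algebra.algebraMap_eq_smul_one, smul_mul_assoc, one_mul, ← sub_smul, smul_smul,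
        inv_mul_cancel₀ (hne k hk), one_smul]
    have h2 : Z - complexify T = (Z - complexify (moveEig T lam ψ J s)) +
        ∑ k ∈ J, ((s - lam k : ℝ) : ℂ) • complexify (eigProj ψ k) := by
      rw [moveEig, complexify_add, complexify_sum]
      simp only [complexify_smul]
      abel
    have h3 : (Z - complexify T) * (R₁ * p) = p := by
      rw [h2, add_mul, ← mul_assoc, hmul₁, one_mul, Finset.sum_mul, Finset.sum_eq_zero, add_zero]
      intro k hk
      rw [smul_mul_assoc, hq k hk, smul_zero]
    rw [mul_add, h3, Finset.mul_sum, Finset.sum_congr rfl h1, hp, complexify_sub, complexify_one,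
      complexify_sum]
    abel
  calc resolvent (complexify T) z = resolvent (complexify T) z * ((Z - complexify T) *
        (∑ k ∈ J, (z - lam k)⁻¹ • complexify (eigProj ψ k) + R₁ * p)) := by
        rw [hright, mul_one]
    _ = _ := by
        rw [← mul_assoc, resolvent, Ring.inverse_mul_cancel _ hu, one_mul]

end Riesz


/-! ### Eigenvector expansion of the reduced resolvent -/

section OffDiagonal

variable {H : Type*} [NormedAddCommGroup H] [InnerProductSpace ℝ H] [CompleteSpace H]
  {T : H →L[ℝ] H} {lam : SpecIndex H → ℝ} {ψ : SpecIndex H → H}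

theorem inner_residualProj (ψ : SpecIndex H → H) (k : SpecIndex H) (v : H) :
    ⟪ψ k, residualProj ψ v⟫_ℝ = 0 :=
  mem_span_range_orthogonal_iff.1 (Submodule.starProjection_apply_mem _ v) k

/-- Bessel's inequality gives convergence to some y with the same coefficients as v. Then v - y is
orthogonal to all ψ_k and y to their orthogonal complement, so v - y is the residual projection.
Convergence is only pointwise in v. -/
theorem hasSum_eigProj (hψ : Orthonormal ℝ ψ) (v : H) :
    HasSum (fun k => eigProj ψ k v) (v - residualProj ψ v) := by
  have hs : Summable fun k => eigProj ψ k v :=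
    (hψ.orthogonalFamily.summable_iff_norm_sq_summable fun k => ⟪ψ k, v⟫_ℝ).2
      (hψ.inner_products_summable v)
  obtain ⟨y, hy⟩ := hs
  have hinner : ∀ u, HasSum (fun k => ⟪ψ k, v⟫_ℝ * ⟪u, ψ k⟫_ℝ) ⟪u, y⟫_ℝ := fun u => by
    have := hy.mapL (innerSL ℝ u)
    simpa [eigProj_apply, inner_smul_right] using this
  have hψy : ∀ k, ⟪ψ k, y⟫_ℝ = ⟪ψ k, v⟫_ℝ := fun k => by
    refine (hinner (ψ k)).unique ?_
    have := hasSum_single (f := fun l => ⟪ψ l, v⟫_ℝ * ⟪ψ k, ψ l⟫_ℝ) k fun l hl => by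
      rw [hψ.2 hl.symm, mul_zero]
    simpa [real_inner_self_eq_norm_sq, hψ.1] using this
  have hres : residualProj ψ v = v - y := by
    refine Submodule.eq_starProjection_of_mem_of_inner_eq_zero
      (mem_span_range_orthogonal_iff.2 fun k => by rw [inner_sub_right, hψy, sub_self])
      fun w hw => ?_
    rw [sub_sub_cancel, real_inner_comm]
    refine (hinner w).unique ?_
    have hw0 : ∀ k, ⟪w, ψ k⟫_ℝ = 0 := fun k => by
      rw [real_inner_comm]; exact mem_span_range_orthogonal_iff.1 hw k
    simp only [hw0, mul_zero]
    exact hasSum_zero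
  rwa [hres, sub_sub_cancel]

/-- The case v = 0 carries no condition on t, so that the residual projection may vanish while t =
0. -/
theorem resolvent_apply_eigenvector {t : ℝ}
    (ht : t ∈ resolventSet ℝ T) {v : H} {m : ℝ} (hv : T v = m • v) (hm : v ≠ 0 → t ≠ m) :
    resolvent T t v = (t - m)⁻¹ • v := by
  have hinv : ∀ x, resolvent T t ((algebraMap ℝ (H →L[ℝ] H) t - T) x) = x := fun x => by
    have : resolvent T t * (algebraMap ℝ (H →L[ℝ] H) t - T) = 1 := Ring.inverse_mul_cancel _ ht
    rw [← mul_apply_eq_comp, this, one_apply_eq_self]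
  rcases eq_or_ne v 0 with rfl | hv0
  · simp
  have h1 : (algebraMap ℝ (H →L[ℝ] H) t - T) v = (t - m) • v := by
    rw [sub_apply, hv, Algebra.algebraMap_eq_smul_one, sub_smul]; simp
  have h2 := hinv v
  rw [h1, map_smul] at h2
  exact (eq_inv_smul_iff₀ (sub_ne_zero.2 (hm hv0))).2 h2

/-- The part of the resolvent of `T` at `t` belonging to the indices outside `J` and to the
residual projection. -/
noncomputable def reducedResolvent (T : H →L[ℝ] H) (lam : SpecIndex H → ℝ) (ψ : SpecIndex H → H)
    (J : Finset (SpecIndex H)) (s t : ℝ) : H →L[ℝ] H :=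
  resolvent (moveEig T lam ψ J s) t * (1 - ∑ k ∈ J, eigProj ψ k)

/-- The resolvent of the displaced operator is applied to the expansion of v without its
J-components: it acts as (t - λ_l)⁻¹ on ψ_l for l outside J and as t⁻¹ on the residual part. -/
theorem hasSum_reducedResolvent (h : IsDiagonal T lam ψ) (hψ : Orthonormal ℝ ψ)
    (J : Finset (SpecIndex H)) {s t : ℝ} (ht : t ∈ resolventSet ℝ (moveEig T lam ψ J s))
    (hne : ∀ l ∉ J, t ≠ lam l) (h0 : ∀ v, residualProj ψ v ≠ 0 → t ≠ 0) (v : H) :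
    HasSum (fun l : {l : SpecIndex H // l ∉ J} => (t - lam l)⁻¹ • eigProj ψ l v)
      (reducedResolvent T lam ψ J s t v - t⁻¹ • residualProj ψ v) := by
  classical
  have hd := h.isDiagonal_moveEig hψ J s
  have hsum : HasSum (fun l : {l : SpecIndex H // l ∉ J} => eigProj ψ l v)
      (v - residualProj ψ v - ∑ k ∈ J, eigProj ψ k v) := by
    have := (J.hasSum_compl_iff (f := fun l => eigProj ψ l v)
      (a := v - residualProj ψ v - ∑ k ∈ J, eigProj ψ k v)).2
      (by rw [sub_add_cancel]; exact hasSum_eigProj hψ v)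
    exact this
  have h1 := hsum.mapL (resolvent (moveEig T lam ψ J s) t)
  have hres : resolvent (moveEig T lam ψ J s) t (residualProj ψ v) = t⁻¹ • residualProj ψ v := by
    have := resolvent_apply_eigenvector ht (v := residualProj ψ v) (m := 0)
      (by rw [hd.apply_of_orthogonal _ fun k => inner_residualProj ψ k v, zero_smul]) (h0 v)
    rwa [sub_zero] at this
  convert h1 using 1
  · ext l
    have := resolvent_apply_eigenvector ht (v := ψ l) (m := lam l)
      (by rw [hd.apply_self, if_neg l.2]) (fun _ => hne l l.2)
    rw [eigProj_apply, map_smul, this, smul_comm]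
  · rw [sub_right_comm, map_sub, hres, reducedResolvent, mul_apply_eq_comp]
    simp

/-- This upgrades convergence of vectors to convergence in operator norm: Q_l E Q_k is the rank-one
operator built from Q_l E ψ_k and ψ_k. -/
theorem hasSum_rankOne_left {ι : Type*} {g : ι → H} {x : H} (hg : HasSum g x) (y : H) :
    HasSum (fun i => InnerProductSpace.rankOne ℝ (g i) y) (InnerProductSpace.rankOne ℝ x y) := by
  let φ : H →+ (H →L[ℝ] H) :=
    { toFun := fun x => InnerProductSpace.rankOne ℝ x y
      map_zero' := by simp
      map_add' := fun a b => by simp }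
  have hφ : Continuous φ := by
    change Continuous fun x => InnerProductSpace.rankOne ℝ x y
    fun_prop
  exact hg.map φ hφ

/-- The off-diagonal first-order terms sum up to products with the reduced resolvent. -/
theorem hasSum_offDiagTerm (h : IsDiagonal T lam ψ) (hψ : Orthonormal ℝ ψ)
    (J : Finset (SpecIndex H)) {s : ℝ} (k : SpecIndex H)
    (ht : lam k ∈ resolventSet ℝ (moveEig T lam ψ J s))
    (hne : ∀ l ∉ J, lam k ≠ lam l) (h0 : ∀ v, residualProj ψ v ≠ 0 → lam k ≠ 0)
    (E : H →L[ℝ] H) :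
    HasSum (fun l : {l : SpecIndex H // l ∉ J} => offDiagTerm lam ψ E k l)
      (eigProj ψ k * E * reducedResolvent T lam ψ J s (lam k) +
        reducedResolvent T lam ψ J s (lam k) * E * eigProj ψ k - residualTerm lam ψ E k) := by
  set S := reducedResolvent T lam ψ J s (lam k) with hS
  have hpt := fun v => hasSum_reducedResolvent h hψ J ht hne h0 v
  have h1 : HasSum (fun l : {l : SpecIndex H // l ∉ J} =>
      (lam k - lam l)⁻¹ • (eigProj ψ l * E * eigProj ψ k))
      (S * E * eigProj ψ k - (lam k)⁻¹ • (residualProj ψ * E * eigProj ψ k)) := by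
    have hterm : ∀ l : {l : SpecIndex H // l ∉ J},
        (lam k - lam l)⁻¹ • (eigProj ψ l * E * eigProj ψ k) =
        InnerProductSpace.rankOne ℝ ((lam k - lam l)⁻¹ • eigProj ψ l (E (ψ k))) (ψ k) := fun l => by
      ext v
      simp only [smul_apply, mul_apply_eq_comp, eigProj_apply ψ k, map_smul,
        InnerProductSpace.rankOne_apply, smul_comm (lam k - lam _)⁻¹]
    have hsum : S * E * eigProj ψ k - (lam k)⁻¹ • (residualProj ψ * E * eigProj ψ k) =
        InnerProductSpace.rankOne ℝ (S (E (ψ k)) - (lam k)⁻¹ • residualProj ψ (E (ψ k))) (ψ k) := by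
      ext v
      simp only [sub_apply, smul_apply, mul_apply_eq_comp, eigProj_apply ψ k, map_smul,
        InnerProductSpace.rankOne_apply, smul_sub]
      rw [smul_comm (lam k)⁻¹]
    simp only [hterm]
    rw [hsum]
    exact hasSum_rankOne_left (hpt (E (ψ k))) (ψ k)
  have h2 : HasSum (fun l : {l : SpecIndex H // l ∉ J} =>
      (lam k - lam l)⁻¹ • (eigProj ψ k * E * eigProj ψ l))
      (eigProj ψ k * E * S - (lam k)⁻¹ • (eigProj ψ k * E * residualProj ψ)) := by
    -- Q_k E Q_l is rank one with second vector Q_l E* ψ_k, so the vector expansion at E* ψ_k gives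
    -- norm summability. The sum is then identified pointwise.
    have hs : Summable (fun l : {l : SpecIndex H // l ∉ J} =>
        (lam k - lam l)⁻¹ • (eigProj ψ k * E * eigProj ψ l)) := by
      have := ((InnerProductSpace.rankOne ℝ (ψ k)).hasSum (hpt (E.adjoint (ψ k)))).summable
      convert this using 1
      ext l v
      simp [eigProj_apply, smul_smul, real_inner_comm]
      rw [ContinuousLinearMap.adjoint_inner_right, real_inner_comm (ψ k), mul_right_comm, mul_assoc]
    obtain ⟨X, hX⟩ := hs
    have : X = eigProj ψ k * E * S - (lam k)⁻¹ • (eigProj ψ k * E * residualProj ψ) := by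
      ext v
      refine (hX.mapL (ContinuousLinearMap.apply ℝ H v)).unique ?_
      have := (hpt v).mapL (eigProj ψ k * E)
      convert this using 1
      · ext l
        simp [map_smul]
      · simp [map_sub, map_smul, hS]
    rwa [this] at hX
  convert h2.add h1 using 1
  · ext l : 1
    rw [offDiagTerm, smul_add]
  · rw [residualTerm, smul_add]
    abel

end OffDiagonal

/-! ### Contour integrals of resolvent-type functions in a Banach algebra -/

section Algebra

variable {𝒜 : Type*} [NormedRing 𝒜] [NormedAlgebra ℂ 𝒜] [CompleteSpace 𝒜]
variable {θ : ℕ → ℝ} {r ρ : ℝ} {K : ℕ}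

theorem continuousOn_inv_sub {a : ℂ} (ha : a ∈ diskChain θ r K) :
    ContinuousOn (fun z : ℂ => (z - a)⁻¹) (chainBoundary θ r K) :=
  ContinuousOn.inv₀ (by fun_prop) fun _ hz => sub_ne_zero_of_mem_chainBoundary ha hz

theorem contourInt_smul_sum_add (hr : 0 < r)
    (hθ : ∀ i j, i < j → j < K → θ i < θ j) (hK : 0 < K) (hρ : r < ρ) {ι : Type*} (J : Finset ι)
    {a : ι → ℝ} (ha : ∀ k ∈ J, (a k : ℂ) ∈ diskChain θ r K) (q : ι → 𝒜) {S : ℂ → 𝒜} {f : ℂ → ℂ}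
    (hS : DifferentiableOn ℂ S (diskChain θ ρ K)) (hf : DifferentiableOn ℂ f (diskChain θ ρ K)) :
    contourInt θ r K (fun z => f z • (∑ k ∈ J, (z - a k)⁻¹ • q k + S z)) =
      ∑ k ∈ J, f (a k) • q k := by
  have hsub := chainBoundary_subset_diskChain (θ := θ) (K := K) hρ
  have hfc := hf.continuousOn.mono hsub
  have hterm : ∀ k ∈ J, ContinuousOn (fun z : ℂ => (z - a k)⁻¹ • (f z • q k))
      (chainBoundary θ r K) := fun k hk =>
    (continuousOn_inv_sub (ha k hk)).smul (hfc.smul continuousOn_const)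
  have heq : ∀ z, f z • (∑ k ∈ J, (z - a k)⁻¹ • q k + S z) =
      ∑ k ∈ J, (z - a k)⁻¹ • (f z • q k) + f z • S z := fun z => by
    rw [smul_add, Finset.smul_sum]
    simp only [smul_comm (f z)]
  simp only [heq]
  rw [contourInt_add hr hθ (g₁ := fun z => ∑ k ∈ J, (z - a k)⁻¹ • (f z • q k))
    (g₂ := fun z => f z • S z) (continuousOn_finsetSum J hterm)
    (hfc.smul (hS.continuousOn.mono hsub)), contourInt_sum hr hθ J hterm,
    contourInt_of_differentiableOn (h := fun z => f z • S z) hr hθ hK hρ (hf.smul hS), add_zero]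
  exact Finset.sum_congr rfl fun k hk =>
    contourInt_inv_sub_smul hr hθ hK hρ (hf.smul_const (q k)) (ha k hk)

/-- After expanding the product, equal poles give the derivative, distinct poles the divided
difference, a single pole evaluates S there, and the pole-free term integrates to zero. -/
theorem contourInt_smul_mul_mul (hr : 0 < r)
    (hθ : ∀ i j, i < j → j < K → θ i < θ j) (hK : 0 < K) (hρ : r < ρ) (Θ : Finset ℝ)
    (hΘ : ∀ t ∈ Θ, (t : ℂ) ∈ diskChain θ r K) (p : ℝ → 𝒜) (e : 𝒜) {S : ℂ → 𝒜} {f : ℂ → ℂ}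
    (hS : DifferentiableOn ℂ S (diskChain θ ρ K)) (hf : DifferentiableOn ℂ f (diskChain θ ρ K)) :
    contourInt θ r K (fun z => f z • ((∑ t ∈ Θ, (z - t)⁻¹ • p t + S z) * e *
        (∑ t ∈ Θ, (z - t)⁻¹ • p t + S z))) =
      ∑ t ∈ Θ, deriv f t • (p t * e * p t) +
      ∑ t ∈ Θ, ∑ u ∈ Θ.erase t, ((f u - f t) / ((u : ℂ) - t)) • (p t * e * p u) +
      ∑ t ∈ Θ, f t • (p t * e * S t + S t * e * p t) := by
  have hsub := chainBoundary_subset_diskChain (θ := θ) (K := K) hρ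
  have hfc := hf.continuousOn.mono hsub
  have hc2 : ∀ t ∈ Θ, ∀ u ∈ Θ, ContinuousOn
      (fun z : ℂ => ((z - t)⁻¹ * (z - u)⁻¹) • (f z • (p t * e * p u))) (chainBoundary θ r K) :=
    fun t ht u hu => ((continuousOn_inv_sub (hΘ t ht)).mul (continuousOn_inv_sub (hΘ u hu))).smul
      (hfc.smul continuousOn_const)
  have hd1 : ∀ t ∈ Θ, DifferentiableOn ℂ (fun z : ℂ => f z • (p t * e * S z + S z * e * p t))
      (diskChain θ ρ K) := fun t _ =>
    hf.smul (((differentiableOn_const _).mul hS).add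
      ((hS.mul (differentiableOn_const _)).mul (differentiableOn_const _)))
  have hc1 : ∀ t ∈ Θ, ContinuousOn
      (fun z : ℂ => (z - t)⁻¹ • (f z • (p t * e * S z + S z * e * p t))) (chainBoundary θ r K) :=
    fun t ht => (continuousOn_inv_sub (hΘ t ht)).smul ((hd1 t ht).continuousOn.mono hsub)
  have hd0 : DifferentiableOn ℂ (fun z : ℂ => f z • (S z * e * S z)) (diskChain θ ρ K) :=
    hf.smul ((hS.mul (differentiableOn_const _)).mul hS)
  have heq : ∀ z, f z • ((∑ t ∈ Θ, (z - t)⁻¹ • p t + S z) * e *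
        (∑ t ∈ Θ, (z - t)⁻¹ • p t + S z)) =
      ∑ t ∈ Θ, ∑ u ∈ Θ, ((z - t)⁻¹ * (z - u)⁻¹) • (f z • (p t * e * p u)) +
      ∑ t ∈ Θ, (z - t)⁻¹ • (f z • (p t * e * S z + S z * e * p t)) + f z • (S z * e * S z) := by
    intro z
    have h1 : (∑ t ∈ Θ, (z - t)⁻¹ • p t) * e * (∑ t ∈ Θ, (z - t)⁻¹ • p t) =
        ∑ t ∈ Θ, ∑ u ∈ Θ, ((z - t)⁻¹ * (z - u)⁻¹) • (p t * e * p u) := by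
      rw [Finset.sum_mul, Finset.sum_mul]
      refine Finset.sum_congr rfl fun t _ => ?_
      rw [Finset.mul_sum]
      refine Finset.sum_congr rfl fun u _ => ?_
      rw [smul_mul_assoc, smul_mul_assoc, mul_smul_comm, smul_smul]
    have h2 : (∑ t ∈ Θ, (z - t)⁻¹ • p t) * e * S z + S z * e * (∑ t ∈ Θ, (z - t)⁻¹ • p t) =
        ∑ t ∈ Θ, (z - t)⁻¹ • (p t * e * S z + S z * e * p t) := by
      simp only [Finset.sum_mul, Finset.mul_sum, smul_mul_assoc, mul_smul_comm, smul_add,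
        Finset.sum_add_distrib]
    have h3 : (∑ t ∈ Θ, (z - t)⁻¹ • p t + S z) * e * (∑ t ∈ Θ, (z - t)⁻¹ • p t + S z) =
        (∑ t ∈ Θ, (z - t)⁻¹ • p t) * e * (∑ t ∈ Θ, (z - t)⁻¹ • p t) +
        ((∑ t ∈ Θ, (z - t)⁻¹ • p t) * e * S z + S z * e * (∑ t ∈ Θ, (z - t)⁻¹ • p t)) +
        S z * e * S z := by
      noncomm_ring
    rw [h3, h1, h2, smul_add, smul_add, Finset.smul_sum, Finset.smul_sum]
    simp only [Finset.smul_sum, smul_comm (f z)]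
  simp only [heq]
  have hcs := continuousOn_finsetSum Θ fun t ht => continuousOn_finsetSum Θ (hc2 t ht)
  have hcs1 := continuousOn_finsetSum Θ hc1
  rw [contourInt_add hr hθ (g₁ := fun z =>
      ∑ t ∈ Θ, ∑ u ∈ Θ, ((z - t)⁻¹ * (z - u)⁻¹) • (f z • (p t * e * p u)) +
        ∑ t ∈ Θ, (z - t)⁻¹ • (f z • (p t * e * S z + S z * e * p t)))
    (hcs.add hcs1) (hd0.continuousOn.mono hsub), contourInt_add hr hθ hcs hcs1,
    contourInt_sum hr hθ Θ (g := fun t z =>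
      ∑ u ∈ Θ, ((z - t)⁻¹ * (z - u)⁻¹) • (f z • (p t * e * p u)))
      (fun t ht => continuousOn_finsetSum Θ (hc2 t ht)),
    contourInt_sum hr hθ Θ hc1, contourInt_of_differentiableOn hr hθ hK hρ hd0, add_zero]
  refine congrArg₂ (· + ·) ?_ ?_
  · rw [← Finset.sum_add_distrib]
    refine Finset.sum_congr rfl fun t ht => ?_
    rw [contourInt_sum hr hθ Θ (hc2 t ht), ← Finset.add_sum_erase Θ _ ht]
    congr 1
    · rw [contourInt_inv_sq_smul hr hθ hK hρ (hf.smul_const _) (hΘ t ht)]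
      have hmem : (t : ℂ) ∈ diskChain θ ρ K := by
        obtain ⟨i, hi, h⟩ := hΘ t ht
        exact ⟨i, hi, h.trans hρ⟩
      exact deriv_smul_const ((hf _ hmem).differentiableAt (isOpen_diskChain.mem_nhds hmem)) _
    · refine Finset.sum_congr rfl fun u hu => ?_
      rw [contourInt_inv_mul_inv_smul hr hθ hK hρ (hf.smul_const _) (hΘ t ht)
        (hΘ u (Finset.mem_of_mem_erase hu)) (Finset.ne_of_mem_erase hu).symm, ← sub_smul,
        smul_smul, inv_mul_eq_div]
  · exact Finset.sum_congr rfl fun t ht =>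
      contourInt_inv_sub_smul hr hθ hK hρ (hd1 t ht) (hΘ t ht)

/-- The second-order resolvent expansion. -/
theorem resolvent_expansion {a b : 𝒜} {z : ℂ} (ha : z ∈ resolventSet ℂ a)
    (hb : z ∈ resolventSet ℂ b) :
    resolvent b z - resolvent a z - resolvent a z * (b - a) * resolvent a z =
      resolvent a z * (b - a) * resolvent a z * (b - a) * resolvent b z := by
  have key : resolvent b z - resolvent a z = resolvent a z * (b - a) * resolvent b z := by
    have h1 : resolvent a z * (algebraMap ℂ 𝒜 z - a) = 1 := Ring.inverse_mul_cancel _ ha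
    have h2 : (algebraMap ℂ 𝒜 z - b) * resolvent b z = 1 := Ring.mul_inverse_cancel _ hb
    have h3 : b - a = (algebraMap ℂ 𝒜 z - a) - (algebraMap ℂ 𝒜 z - b) := by abel
    rw [h3, mul_sub, h1, sub_mul, one_mul, mul_assoc, h2, mul_one]
  calc _ = resolvent a z * (b - a) * resolvent b z - resolvent a z * (b - a) * resolvent a z := by
        rw [key]
    _ = resolvent a z * (b - a) * (resolvent b z - resolvent a z) := (mul_sub _ _ _).symm
    _ = _ := by rw [key]; simp only [mul_assoc]

end Algebra


/-! ### Ordering the distinct eigenvalues -/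

section Enumeration

/-- Increasing enumeration of a finite set of reals by natural numbers. -/
theorem exists_strictMono_enumeration (Θ : Finset ℝ) :
    ∃ θ : ℕ → ℝ, (∀ i j, i < j → j < Θ.card → θ i < θ j) ∧ ∀ x, x ∈ Θ ↔ ∃ i < Θ.card, θ i = x := by
  refine ⟨fun i => if h : i < Θ.card then Θ.orderEmbOfFin rfl ⟨i, h⟩ else 0, fun i j hij hj => ?_,
    fun x => ⟨fun hx => ?_, ?_⟩⟩
  · simp only
    rw [dif_pos hj, dif_pos (hij.trans hj)]
    exact (Θ.orderEmbOfFin rfl).strictMono hij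
  · have : x ∈ Set.range (Θ.orderEmbOfFin rfl) := by rw [Finset.range_orderEmbOfFin]; exact hx
    obtain ⟨i, hi⟩ := this
    exact ⟨i.1, i.2, by simp only [i.2, dite_true]; exact hi⟩
  · rintro ⟨i, hi, rfl⟩
    simp only [hi, dite_true]
    exact Finset.orderEmbOfFin_mem _ _ _

end Enumeration

/-! ### Assembly: contour geometry, gradient terms and the remainder estimate -/

section Main

variable {H : Type*} [NormedAddCommGroup H] [InnerProductSpace ℝ H]
  {T : H →L[ℝ] H} {lam : SpecIndex H → ℝ} {ψ : SpecIndex H → H} {J : Finset (SpecIndex H)}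
  {θ : ℕ → ℝ}

/-- For empty J the gap is `sInf ∅`, which is 0 by convention. -/
theorem nonempty_of_gap_pos (hgap : 0 < gap lam J) : J.Nonempty := by
  by_contra h
  rw [Finset.not_nonempty_iff_eq_empty] at h
  simp [gap, h] at hgap

theorem diskUnion_eq_diskChain
    (hΘ : ∀ x, x ∈ distinctEig lam J ↔ ∃ i < (distinctEig lam J).card, θ i = x) :
    diskUnion lam J = diskChain θ (gap lam J / 2) (distinctEig lam J).card := by
  ext z
  simp only [diskUnion, diskChain, Set.mem_iUnion, Metric.mem_ball, dist_eq_norm, exists_prop,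
    Set.mem_ofPred_eq]
  constructor
  · rintro ⟨x, hx, h⟩
    obtain ⟨i, hi, rfl⟩ := (hΘ x).1 hx
    exact ⟨i, hi, h⟩
  · rintro ⟨i, hi, h⟩
    exact ⟨θ i, (hΘ _).2 ⟨i, hi, rfl⟩, h⟩

theorem isCompact_closure_diskUnion : IsCompact (closure (diskUnion lam J)) :=
  Bornology.IsBounded.isCompact_closure
    ((Bornology.isBounded_biUnion_finset _).2 fun _ _ => Metric.isBounded_ball)

theorem chainBoundary_subset_frontier (hgap : 0 < gap lam J)
    (hΘ : ∀ x, x ∈ distinctEig lam J ↔ ∃ i < (distinctEig lam J).card, θ i = x) :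
    chainBoundary θ (gap lam J / 2) (distinctEig lam J).card ⊆ frontier (diskUnion lam J) := by
  intro z hz
  have hopen : IsOpen (diskUnion lam J) := by
    rw [diskUnion_eq_diskChain hΘ]; exact isOpen_diskChain
  rw [frontier, hopen.interior_eq]
  refine ⟨?_, ?_⟩
  · obtain ⟨i, hi, h⟩ := hz.1
    have hsub : Metric.ball (θ i : ℂ) (gap lam J / 2) ⊆ diskUnion lam J :=
      Set.subset_biUnion_of_mem (u := fun θ : ℝ => Metric.ball (θ : ℂ) (gap lam J / 2))
        ((hΘ _).2 ⟨i, hi, rfl⟩)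
    refine closure_mono hsub ?_
    rw [closure_ball _ (by linarith), Metric.mem_closedBall, dist_eq_norm, h]
  · rw [diskUnion_eq_diskChain hΘ]
    rintro ⟨j, hj, h⟩
    exact absurd (hz.2 j hj) (not_le.2 h)

/-- A real `sSup` bounds a set only if the set is bounded above; here the frontier is compact and f
is continuous on it. -/
theorem norm_le_sSup_frontier {f : ℂ → ℂ} {V : Set ℂ} (hUV : closure (diskUnion lam J) ⊆ V)
    (hf : DifferentiableOn ℂ f V) {z : ℂ} (hz : z ∈ frontier (diskUnion lam J)) :
    ‖f z‖ ≤ sSup ((fun z => ‖f z‖) '' frontier (diskUnion lam J)) := by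
  have hc : IsCompact (frontier (diskUnion lam J)) :=
    isCompact_closure_diskUnion.of_isClosed_subset isClosed_frontier frontier_subset_closure
  exact le_csSup (hc.bddAbove_image
    (hf.continuousOn.mono (frontier_subset_closure.trans hUV)).norm) ⟨z, hz, rfl⟩

/-- A neighbourhood of the closed disk union in the form of a chain of slightly larger disks. -/
theorem exists_diskChain_subset (hgap : 0 < gap lam J)
    (hΘ : ∀ x, x ∈ distinctEig lam J ↔ ∃ i < (distinctEig lam J).card, θ i = x)
    {V : Set ℂ} (hV : IsOpen V) (hUV : closure (diskUnion lam J) ⊆ V) :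
    ∃ ρ, gap lam J / 2 < ρ ∧ ρ ≤ 5 / 8 * gap lam J ∧
      diskChain θ ρ (distinctEig lam J).card ⊆ V := by
  obtain ⟨δ, hδ, hsub⟩ := isCompact_closure_diskUnion.exists_thickening_subset_open hV hUV
  -- The first entry keeps the enlarged disks in V. The cap 5γ/8 = 5r/4 leaves a margin of r/4 to
  -- the perturbed outer eigenvalues, since 2r - r/2 - 5r/4 = r/4.
  refine ⟨min (gap lam J / 2 + δ) (5 / 8 * gap lam J), lt_min (by linarith) (by linarith),
    min_le_right _ _, ?_⟩
  rintro z ⟨i, hi, hz⟩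
  have hball : Metric.ball (θ i : ℂ) (gap lam J / 2) ⊆ diskUnion lam J :=
    Set.subset_biUnion_of_mem (u := fun θ : ℝ => Metric.ball (θ : ℂ) (gap lam J / 2))
      ((hΘ _).2 ⟨i, hi, rfl⟩)
  refine hsub (Metric.thickening_subset_of_subset δ hball |>.trans
    (Metric.thickening_subset_of_subset δ subset_closure) ?_)
  rw [thickening_ball hδ (by linarith), Metric.mem_ball, dist_eq_norm]
  linarith [min_le_left (gap lam J / 2 + δ) (5 / 8 * gap lam J)]

theorem sum_inv_sub_smul_eigProj (z : ℂ) :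
    ∑ k ∈ J, (z - lam k)⁻¹ • complexify (eigProj ψ k) =
      ∑ t ∈ distinctEig lam J, (z - t)⁻¹ • complexify (clusterProj lam ψ J t) := by
  rw [← Finset.sum_fiberwise_of_maps_to (s := J) (t := distinctEig lam J) (g := lam)
    fun k hk => Finset.mem_image_of_mem _ hk]
  refine Finset.sum_congr rfl fun t _ => ?_
  rw [clusterProj, complexify_sum, Finset.smul_sum]
  refine Finset.sum_congr rfl fun k hk => ?_
  rw [(Finset.mem_filter.1 hk).2]

variable [CompleteSpace H]

theorem IsDiagonal.mem_resolventSet_moveEig (h : IsDiagonal T lam ψ) (hψ : Orthonormal ℝ ψ)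
    {s : ℝ} {z : ℂ} {c : ℝ} (hc : 0 < c) (hs : c ≤ ‖z - s‖) (hl : ∀ l ∉ J, c ≤ ‖z - lam l‖)
    (h0 : Infinite (SpecIndex H) → c ≤ ‖z‖) :
    z ∈ resolventSet ℂ (complexify (moveEig T lam ψ J s)) := by
  classical
  refine ((h.isDiagonal_moveEig hψ J s).resolvent_bound hψ hc (fun k => ?_) h0).1
  split_ifs with hk
  exacts [hs, hl k hk]

theorem differentiableOn_resolvent_mul {𝒜 : Type*} [NormedRing 𝒜] [NormedAlgebra ℂ 𝒜]
    [CompleteSpace 𝒜] {a b : 𝒜} {U : Set ℂ} (hU : ∀ z ∈ U, z ∈ resolventSet ℂ a) :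
    DifferentiableOn ℂ (fun z => resolvent a z * b) U := fun z hz =>
  ((spectrum.hasDerivAt_resolvent_const_left (hU z hz)).differentiableAt.mul_const
    b).differentiableWithinAt

/-- The inner sum plus the residual term equals Q_k E S(λ_k) + S(λ_k) E Q_k, with S the reduced
resolvent. Since S(λ_k) depends only on the value of λ_k, the Q_k can be collected into cluster
projections. -/
theorem gradCmp₃_eq (h : IsDiagonal T lam ψ) (hψ : Orthonormal ℝ ψ) {s : ℝ}
    (ht : ∀ k ∈ J, lam k ∈ resolventSet ℝ (moveEig T lam ψ J s))
    (hne : ∀ k ∈ J, ∀ l ∉ J, lam k ≠ lam l)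
    (h0 : ∀ k ∈ J, ∀ v, residualProj ψ v ≠ 0 → lam k ≠ 0) (E : H →L[ℝ] H) (f : ℂ → ℂ) :
    gradCmp₃ lam ψ E f J = ∑ t ∈ distinctEig lam J, f t •
      (complexify (clusterProj lam ψ J t) * complexify E *
          (resolvent (complexify (moveEig T lam ψ J s)) (t : ℂ) *
            complexify (1 - ∑ k ∈ J, eigProj ψ k)) +
        (resolvent (complexify (moveEig T lam ψ J s)) (t : ℂ) *
            complexify (1 - ∑ k ∈ J, eigProj ψ k)) * complexify E *
          complexify (clusterProj lam ψ J t)) := by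
  rw [gradCmp₃, ← Finset.sum_fiberwise_of_maps_to (s := J) (t := distinctEig lam J) (g := lam)
    fun k hk => Finset.mem_image_of_mem _ hk]
  refine Finset.sum_congr rfl fun t _ => ?_
  rw [clusterProj, complexify_sum, Finset.sum_mul, Finset.sum_mul, Finset.mul_sum,
    ← Finset.sum_add_distrib, Finset.smul_sum]
  refine Finset.sum_congr rfl fun k hk => ?_
  obtain ⟨hkJ, rfl⟩ := Finset.mem_filter.1 hk
  rw [(hasSum_offDiagTerm h hψ J k (ht k hkJ) (hne k hkJ) (h0 k hkJ) E).tsum_eq, sub_add_cancel,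
    complexify_add, complexify_mul, complexify_mul, complexify_mul, complexify_mul,
    reducedResolvent, complexify_mul, complexify_resolvent (ht k hkJ)]

end Main

end SpecPert

theorem mainTheorem4 {H : Type*} [NormedAddCommGroup H] [InnerProductSpace ℝ H] [CompleteSpace H]
    [TopologicalSpace.SeparableSpace H]
    (T That : H →L[ℝ] H)
    (hT : IsCompactOperator T) (hTsa : IsSelfAdjoint T)
    (hThat : IsCompactOperator That) (hThatsa : IsSelfAdjoint That)
    (lam lamhat : SpecIndex H → ℝ) (ψ ψhat : SpecIndex H → H)
    (hdec : IsEigenDecomposition T lam ψ)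
    (hdechat : IsEigenDecomposition That lamhat ψhat)
    (J : Finset (SpecIndex H)) (hgap : 0 < gap lam J)
    (f : ℂ → ℂ) (V : Set ℂ) (hV : IsOpen V) (hUV : closure (diskUnion lam J) ⊆ V)
    (hf : DifferentiableOn ℂ f V)
    (hclose : ‖That - T‖ / gap lam J < 1 / 4) :
    (∀ k ∈ J, Summable fun l : {l : SpecIndex H // l ∉ J} =>
      offDiagTerm lam ψ (That - T) k l) ∧
    ‖genCmp lamhat ψhat f J - genCmp lam ψ f J - gradCmp lam ψ (That - T) f J‖ ≤
      8 * ((distinctEig lam J).card : ℝ) *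
        sSup ((fun z => ‖f z‖) '' frontier (diskUnion lam J)) *
        (‖That - T‖ / gap lam J) ^ 2 := by
  have hψ := hdec.orthonormal
  have hψ' := hdechat.orthonormal
  have hD := hdec.isDiagonal
  have hD' := hdechat.isDiagonal
  set E := That - T with hE
  set Θ := distinctEig lam J with hΘdef
  set K := Θ.card
  obtain ⟨r, hr⟩ : ∃ r, r = gap lam J / 2 := ⟨_, rfl⟩
  have hr0 : 0 < r := by linarith
  have hγ : gap lam J = 2 * r := by linarith
  have hEr : ‖E‖ < r / 2 := by
    rw [div_lt_iff₀ hgap] at hclose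
    linarith
  have hE0 : 0 ≤ ‖E‖ := norm_nonneg _
  obtain ⟨θ, hθ, hΘ⟩ := exists_strictMono_enumeration Θ
  obtain ⟨k₀, hk₀⟩ := nonempty_of_gap_pos hgap
  have hK : 0 < K := Finset.card_pos.2 ⟨lam k₀, Finset.mem_image_of_mem _ hk₀⟩
  obtain ⟨ρ, hrρ, hρ, hρV⟩ := exists_diskChain_subset hgap hΘ hV hUV
  rw [← hr] at hrρ
  rw [hγ] at hρ
  obtain ⟨M, hM⟩ := Θ.exists_le
  -- Any point at distance at least 2r from every θ would do; s lies to the right of all of them.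
  set s := M + 2 * r with hs
  have hfρ : DifferentiableOn ℂ f (diskChain θ ρ K) := hf.mono hρV
  have hmemΘ : ∀ i < K, ∃ k ∈ J, lam k = θ i := fun i hi =>
    Finset.mem_image.1 ((hΘ _).2 ⟨i, hi, rfl⟩)
  have hlamΘ : ∀ k ∈ J, ∃ i < K, θ i = lam k := fun k hk =>
    (hΘ _).1 (Finset.mem_image_of_mem _ hk)
  -- distances of the points `θ i` from the remaining eigenvalues
  have hdist : ∀ i < K, ∀ l ∉ J, 2 * r ≤ |θ i - lam l| := fun i hi l hl => by
    obtain ⟨k, hk, h⟩ := hmemΘ i hi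
    rw [← hγ, ← h]
    exact gap_le hk hl
  have hdist0 : Infinite (SpecIndex H) → ∀ i < K, 2 * r ≤ |θ i| := fun hinf i hi => by
    obtain ⟨k, hk, h⟩ := hmemΘ i hi
    rw [← hγ, ← h]
    exact (hdec.gap_le_of_infinite hinf hk).trans (le_abs_self _)
  have hdists : ∀ i < K, 2 * r ≤ |θ i - s| := fun i hi => by
    have := hM _ ((hΘ _).2 ⟨i, hi, rfl⟩)
    rw [abs_sub_comm]
    exact le_trans (by linarith) (le_abs_self _)
  have hweyl := fun k => hdec.abs_sub_le hdechat k
  have htri : ∀ (z : ℂ) (a b : ℝ), |a - b| - ‖z - a‖ ≤ ‖z - b‖ := fun z a b => by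
    have h1 : ‖(a : ℂ) - b‖ = |a - b| := by
      rw [← Complex.ofReal_sub, Complex.norm_real, Real.norm_eq_abs]
    have h2 := norm_sub_le_norm_sub_add_norm_sub (a : ℂ) z b
    rw [norm_sub_rev (a : ℂ) z] at h2
    linarith
  have htri0 : ∀ (z : ℂ) (a : ℝ), |a| - ‖z - a‖ ≤ ‖z‖ := fun z a => by
    simpa using htri z a 0
  -- bounds for the resolvents on the contour
  have hbd : ∀ z ∈ chainBoundary θ r K, (∀ k, r ≤ ‖z - lam k‖) ∧
      (Infinite (SpecIndex H) → r ≤ ‖z‖) := by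
    intro z hz
    obtain ⟨i, hi, hzi⟩ := hz.1
    refine ⟨fun k => ?_, fun hinf => ?_⟩
    · by_cases hk : k ∈ J
      · obtain ⟨j, hj, h⟩ := hlamΘ k hk
        rw [← h]
        exact hz.2 j hj
      · linarith [hdist i hi k hk, htri z (θ i) (lam k)]
    · linarith [hdist0 hinf i hi, htri0 z (θ i)]
  have hR : ∀ z ∈ chainBoundary θ r K, z ∈ resolventSet ℂ (complexify T) ∧
      ‖resolvent (complexify T) z‖ ≤ r⁻¹ := fun z hz =>
    hD.resolvent_bound hψ hr0 (hbd z hz).1 (hbd z hz).2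
  -- By Weyl's inequality each eigenvalue of That stays at distance at least r - ‖E‖ from the
  -- contour, so the diagonal bound applies to That directly, without a Neumann series.
  have hR' : ∀ z ∈ chainBoundary θ r K, z ∈ resolventSet ℂ (complexify That) ∧
      ‖resolvent (complexify That) z‖ ≤ (r - ‖E‖)⁻¹ := fun z hz => by
    refine hD'.resolvent_bound hψ' (by linarith) (fun k => ?_)
      fun hinf => by linarith [(hbd z hz).2 hinf]
    have h1 := (hbd z hz).1 k
    have h2 := hweyl k
    have h3 := norm_sub_le_norm_sub_add_norm_sub z (lamhat k : ℂ) (lam k)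
    rw [← Complex.ofReal_sub, Complex.norm_real, Real.norm_eq_abs] at h3
    linarith
  -- the reduced resolvents on the neighbourhood
  have hS : ∀ z ∈ diskChain θ ρ K, z ∈ resolventSet ℂ (complexify (moveEig T lam ψ J s)) := by
    rintro z ⟨i, hi, hzi⟩
    refine hD.mem_resolventSet_moveEig hψ (c := r / 4) (by linarith) ?_ (fun l hl => ?_)
      fun hinf => ?_
    · linarith [hdists i hi, htri z (θ i) s]
    · linarith [hdist i hi l hl, htri z (θ i) (lam l)]
    · linarith [hdist0 hinf i hi, htri0 z (θ i)]
  have hS' : ∀ z ∈ diskChain θ ρ K,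
      z ∈ resolventSet ℂ (complexify (moveEig That lamhat ψhat J s)) := by
    rintro z ⟨i, hi, hzi⟩
    refine hD'.mem_resolventSet_moveEig hψ' (c := r / 4) (by linarith) ?_ (fun l hl => ?_)
      fun hinf => ?_
    · linarith [hdists i hi, htri z (θ i) s]
    · have := abs_sub_le (θ i) (lamhat l) (lam l)
      linarith [hdist i hi l hl, htri z (θ i) (lamhat l), hweyl l]
    · linarith [hdist0 hinf i hi, htri0 z (θ i)]
  have hlam_mem : ∀ k ∈ J, (lam k : ℂ) ∈ diskChain θ r K := fun k hk => by
    obtain ⟨i, hi, h⟩ := hlamΘ k hk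
    exact ⟨i, hi, by simpa [h] using hr0⟩
  -- The perturbed eigenvalues with index in J stay within ‖E‖ < r/2 of their centres, so the
  -- contour of T also encloses them.
  have hlamhat_mem : ∀ k ∈ J, (lamhat k : ℂ) ∈ diskChain θ r K := fun k hk => by
    obtain ⟨i, hi, h⟩ := hlamΘ k hk
    refine ⟨i, hi, ?_⟩
    rw [h, ← Complex.ofReal_sub, Complex.norm_real, Real.norm_eq_abs]
    linarith [hweyl k]
  have hΘ_mem : ∀ t ∈ Θ, (t : ℂ) ∈ diskChain θ r K := fun t ht => by
    obtain ⟨k, hk, rfl⟩ := Finset.mem_image.1 ht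
    exact hlam_mem k hk
  have hreal : ∀ k ∈ J, lam k ∈ resolventSet ℝ (moveEig T lam ψ J s) := by
    classical
    intro k hk
    obtain ⟨i, hi, h⟩ := hlamΘ k hk
    refine (hD.isDiagonal_moveEig hψ J s).mem_resolventSet_real hψ (d := 2 * r) (by linarith)
      (fun l => ?_) fun hinf => ?_
    · rw [← h]
      split_ifs with hl
      exacts [hdists i hi, hdist i hi l hl]
    · rw [← h]
      exact hdist0 hinf i hi
  have hne : ∀ k ∈ J, ∀ l ∉ J, lam k ≠ lam l := fun k hk l hl heq => by
    have := gap_le (lam := lam) hk hl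
    rw [heq, sub_self, abs_zero] at this
    linarith
  have hres0 : ∀ k ∈ J, ∀ v, residualProj ψ v ≠ 0 → lam k ≠ 0 := fun k hk v hv => by
    have := hdec.gap_le_of_infinite
      (infinite_of_orthogonal hψ hv fun k => inner_residualProj ψ k v) hk
    linarith
  refine ⟨fun k hk => (hasSum_offDiagTerm hD hψ J k (hreal k hk) (hne k hk)
    (hres0 k hk) E).summable, ?_⟩
  -- evaluation of the contour integrals
  set R : ℂ → _ := resolvent (complexify T) with hRdef
  set R' : ℂ → _ := resolvent (complexify That) with hR'def
  set S : ℂ → Complexification H →L[ℂ] Complexification H := fun z =>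
    resolvent (complexify (moveEig T lam ψ J s)) z *
      complexify (1 - ∑ k ∈ J, eigProj ψ k) with hSdef
  have hSd : DifferentiableOn ℂ S (diskChain θ ρ K) := differentiableOn_resolvent_mul hS
  have hsub := chainBoundary_subset_diskChain (θ := θ) (K := K) hrρ
  have hRz : ∀ z ∈ chainBoundary θ r K,
      R z = ∑ k ∈ J, (z - lam k)⁻¹ • complexify (eigProj ψ k) + S z := fun z hz =>
    hD.resolvent_eq hψ hTsa J s (hR z hz).1 (hS z (hsub hz)) fun k hk =>
      sub_ne_zero_of_mem_chainBoundary (hlam_mem k hk) hz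
  have hR'z : ∀ z ∈ chainBoundary θ r K, R' z =
      ∑ k ∈ J, (z - lamhat k)⁻¹ • complexify (eigProj ψhat k) +
        resolvent (complexify (moveEig That lamhat ψhat J s)) z *
          complexify (1 - ∑ k ∈ J, eigProj ψhat k) := fun z hz =>
    hD'.resolvent_eq hψ' hThatsa J s (hR' z hz).1 (hS' z (hsub hz)) fun k hk =>
      sub_ne_zero_of_mem_chainBoundary (hlamhat_mem k hk) hz
  have hI : contourInt θ r K (fun z => f z • R z) = genCmp lam ψ f J := by
    rw [contourInt_congr hr0 hθ (g₂ := fun z => f z •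
      (∑ k ∈ J, (z - lam k)⁻¹ • complexify (eigProj ψ k) + S z))
      fun z hz => by simp only [hRz z hz]]
    exact contourInt_smul_sum_add hr0 hθ hK hrρ J hlam_mem _ hSd hfρ
  have hI' : contourInt θ r K (fun z => f z • R' z) = genCmp lamhat ψhat f J := by
    rw [contourInt_congr hr0 hθ (g₂ := fun z => f z •
      (∑ k ∈ J, (z - lamhat k)⁻¹ • complexify (eigProj ψhat k) +
        resolvent (complexify (moveEig That lamhat ψhat J s)) z *
          complexify (1 - ∑ k ∈ J, eigProj ψhat k)))
      fun z hz => by simp only [hR'z z hz]]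
    exact contourInt_smul_sum_add hr0 hθ hK hrρ J hlamhat_mem _
      (differentiableOn_resolvent_mul hS') hfρ
  have hI₂ : contourInt θ r K (fun z => f z • (R z * complexify E * R z)) =
      gradCmp lam ψ E f J := by
    rw [contourInt_congr hr0 hθ (g₂ := fun z => f z •
      ((∑ t ∈ Θ, (z - t)⁻¹ • complexify (clusterProj lam ψ J t) + S z) * complexify E *
        (∑ t ∈ Θ, (z - t)⁻¹ • complexify (clusterProj lam ψ J t) + S z)))
      fun z hz => by simp only [hRz z hz, sum_inv_sub_smul_eigProj, ← hΘdef],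
      contourInt_smul_mul_mul hr0 hθ hK hrρ Θ hΘ_mem _ _ hSd hfρ, gradCmp,
      gradCmp₃_eq hD hψ hreal hne hres0, gradCmp₁, gradCmp₂]
    simp only [complexify_mul, ← hΘdef, hSdef]
  have hfc := hfρ.continuousOn.mono hsub
  have hRc : ContinuousOn R (chainBoundary θ r K) := fun z hz =>
    (spectrum.hasDerivAt_resolvent_const_left (hR z hz).1).continuousAt.continuousWithinAt
  have hRc' : ContinuousOn R' (chainBoundary θ r K) := fun z hz =>
    (spectrum.hasDerivAt_resolvent_const_left (hR' z hz).1).continuousAt.continuousWithinAt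
  have hmain : genCmp lamhat ψhat f J - genCmp lam ψ f J - gradCmp lam ψ E f J =
      contourInt θ r K
        (fun z => f z • (R z * complexify E * R z * complexify E * R' z)) := by
    rw [← hI, ← hI', ← hI₂, ← contourInt_sub (g₁ := fun z => f z • R' z)
        (g₂ := fun z => f z • R z) hr0 hθ (hfc.smul hRc') (hfc.smul hRc),
      ← contourInt_sub (g₁ := fun z => f z • R' z - f z • R z)
        (g₂ := fun z => f z • (R z * complexify E * R z)) hr0 hθ
        ((hfc.smul hRc').sub (hfc.smul hRc)) (hfc.smul ((hRc.mul continuousOn_const).mul hRc))]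
    refine contourInt_congr hr0 hθ fun z hz => ?_
    have := resolvent_expansion (hR z hz).1 (hR' z hz).1
    rw [← complexify_sub, ← hE] at this
    simp only [hRdef, hR'def]
    rw [← this, smul_sub, smul_sub]
  -- the estimate
  set B := sSup ((fun z => ‖f z‖) '' frontier (diskUnion lam J)) with hB
  have hB0 : 0 ≤ B := Real.sSup_nonneg (by rintro _ ⟨z, _, rfl⟩; exact norm_nonneg _)
  have hrE : 0 < r - ‖E‖ := by linarith
  rw [hmain]
  have hest := norm_contourInt_le hr0 hθ (K := K)
    (g := fun z => f z • (R z * complexify E * R z * complexify E * R' z))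
    (C := B * (r⁻¹ * ‖E‖ * r⁻¹ * ‖E‖ * (r - ‖E‖)⁻¹)) (by positivity) fun z hz => by
      rw [norm_smul]
      have h1 := norm_le_sSup_frontier hUV hf
        (chainBoundary_subset_frontier hgap hΘ (by rw [← hr]; exact hz))
      have h2 := (hR z hz).2
      have h3 := (hR' z hz).2
      have h4 := norm_complexify_le E
      refine mul_le_mul h1 ?_ (norm_nonneg _) hB0
      refine (norm_mul_le _ _).trans (mul_le_mul ?_ h3 (norm_nonneg _) (by positivity))
      refine (norm_mul_le _ _).trans (mul_le_mul ?_ h4 (norm_nonneg _) (by positivity))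
      refine (norm_mul_le _ _).trans (mul_le_mul ?_ h2 (norm_nonneg _) (by positivity))
      exact (norm_mul_le _ _).trans (mul_le_mul h2 h4 (norm_nonneg _) (by positivity))
  refine hest.trans ?_
  have hinv : (r - ‖E‖)⁻¹ ≤ 2 * r⁻¹ := by
    rw [← div_eq_mul_inv, inv_le_comm₀ hrE (div_pos two_pos hr0), inv_div]
    linarith
  -- The powers of r combine to 2 K B ‖E‖² / r², and r = γ/2 turns the factor 2 into 8.
  calc (K : ℝ) * r * (B * (r⁻¹ * ‖E‖ * r⁻¹ * ‖E‖ * (r - ‖E‖)⁻¹))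
      ≤ K * r * (B * (r⁻¹ * ‖E‖ * r⁻¹ * ‖E‖ * (2 * r⁻¹))) :=
        mul_le_mul_of_nonneg_left (mul_le_mul_of_nonneg_left
          (mul_le_mul_of_nonneg_left hinv (by positivity)) hB0)
          (mul_nonneg (Nat.cast_nonneg _) hr0.le)
    _ = 8 * K * B * (‖E‖ / gap lam J) ^ 2 := by
      rw [hγ]
      field_simp
      ring
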